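/- Let $0<q<1$. For $j\in\mathbb{Z}_{\ge 0}\cup\{\infty\}$ write $(a;q)_j=\prod_{0\le i<j}(1-aq^i)$, $(a_1,\dots,a_m;q)_j=\prod_{k}(a_k;q)_j$, and let $$ {}_8W_7(\alpha_0;\alpha_1,\dots,\alpha_5;q,w)=\sum_{r=0}^{\infty}\frac{1-\alpha_0q^{2r}}{1-\alpha_0}\,w^r\prod_{j=0}^{5}\frac{(\alpha_j;q)_r}{(q\alpha_0/\alpha_j;q)_r} \qquad(|w|<1) $$ be the very-well-poised ${}_8\phi_7$ series (defined when $\alpha_0\neq 1$ and no factor $(q\alpha_0/\alpha_j;q)_r$ vanishes). Let $\alpha,\beta,x\in\mathbb{C}\setminus\{0\}$ with $q^{n}x^2\neq 1$ for all integers $n\ge 1$. Consider, for $z\in\mathbb{C}\setminus\{0\}$, the identity $$ \frac{\bigl(-q^{\frac12}\alpha xz,\,-q^{\frac12}\beta z,\,\frac{q^{\frac32}xz}{\alpha};q\bigr)_\infty}{\bigl(-\frac{q^{\frac32}x^2z}{\beta};q\bigr)_\infty}\; {}_8W_7\Bigl(-\frac{q^{\frac12}x^2z}{\beta};\frac{qx}{\alpha\beta},-q^{\frac12}x,-\frac{\alpha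 x}{\beta},q^{\frac12}x,-\frac{q^{\frac12}z}{\beta};q,-q^{\frac12}\beta z\Bigr) $$ $$ =\frac{\bigl(-q\alpha\beta xz^2,\,\frac{q^2\alpha xz^2}{\beta},\,-\frac{q^2xz^2}{\alpha\beta},\,\frac{q^3\beta xz^2}{\alpha};q^2\bigr)_\infty}{\bigl(-q^3x^2z^2,\,-q^2z^2,\,\frac{q^2x^2z^2}{\beta^2};q^2\bigr)_\infty}\; {}_8W_7\Bigl(-qx^2z^2;\frac{q^2x}{\alpha\beta},-\frac{q\beta x}{\alpha},-\frac{\alpha x}{\beta},q\alpha\beta x,-qz^2;q^2,-qz^2\Bigr). \qquad(*) $$ (1) If $|q^{\frac12}\beta z|<1$ and $|qz^2|<1$, and none of the denominators occurring in the two series or in the two prefactors vanishes, then both series converge absolutely and $(*)$ holds. (2) Both ${}_8W_7$ series in $(*)$, as functions of $z$ (with $q,\alpha,\beta,x$ fixed), extend to meromorphic functions on $\mathbb{C}\setminus\{0\}$ (each agreeing with its series wherever that series is defined and its argument has modulus less than one), and $(*)$ holds as an identity of meromorphic functions of $z\in\mathbb{C}\setminus\{0\}$, i.e. outside a closed discrete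 subset of $\mathbb{C}\setminus\{0\}$. -/

import Mathlib

open Filter

noncomputable section

/-- The finite `q`-shifted factorial `(a; q)_r = ∏_{i < r} (1 - a q^i)`. -/
def qFact (q a : ℂ) (r : ℕ) : ℂ := ∏ i ∈ Finset.range r, (1 - a * q ^ i)

/-- The infinite `q`-shifted factorial `(a; q)_∞ = ∏_{i ≥ 0} (1 - a q^i)`. -/
def qFactInf (q a : ℂ) : ℂ := ∏' i : ℕ, (1 - a * q ^ i)

/-- The product `(a₁, …, aₘ; q)_∞ = (a₁; q)_∞ ⋯ (aₘ; q)_∞`. -/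
def qFactInfs (q : ℂ) (l : List ℂ) : ℂ := (l.map (qFactInf q)).prod

/-- The `r`-th term of the very-well-poised series `₈W₇(a₀; a₁, …, a₅; q, w)`,
`(1 - a₀ q^{2r}) / (1 - a₀) * w^r * ∏_{j=0}^5 (a_j; q)_r / (q a₀ / a_j; q)_r`. -/
def vwpTerm (a : Fin 6 → ℂ) (q w : ℂ) (r : ℕ) : ℂ :=
  (1 - a 0 * q ^ (2 * r)) / (1 - a 0) * w ^ r *
    ∏ j : Fin 6, qFact q (a j) r / qFact q (q * a 0 / a j) r

/-- The sum of the very-well-poised series `₈W₇(a₀; a₁, …, a₅; q, w)`. -/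
def W87 (a : Fin 6 → ℂ) (q w : ℂ) : ℂ := ∑' r : ℕ, vwpTerm a q w r

/-- No denominator in the series `₈W₇(a₀; a₁, …, a₅; q, w)` vanishes:
`a₀ ≠ 1`, and no `(q a₀ / a_j; q)_r` is zero. -/
def VWPGeneric (a : Fin 6 → ℂ) (q : ℂ) : Prop :=
  a 0 ≠ 1 ∧ ∀ (j : Fin 6) (n : ℕ), q * a 0 / a j * q ^ n ≠ 1

/-- `q^{1/2}` for a positive real `q`, as a complex number. -/
def qHalf (q : ℝ) : ℂ := ((Real.sqrt q : ℝ) : ℂ)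

/-- Parameters of the `₈W₇` in base `q`. -/
def lhsParams (q : ℝ) (α β x z : ℂ) : Fin 6 → ℂ :=
  ![-(qHalf q * x ^ 2 * z / β),
    q * x / (α * β), -(qHalf q * x), -(α * x / β), qHalf q * x, -(qHalf q * z / β)]

/-- Argument of the `₈W₇` in base `q`. -/
def lhsArg (q : ℝ) (β z : ℂ) : ℂ := -(qHalf q * β * z)

/-- Numerator of the prefactor of the `₈W₇` in base `q`. -/
def lhsNum (q : ℝ) (α β x z : ℂ) : ℂ :=
  qFactInfs q [-(qHalf q * α * x * z), -(qHalf q * β * z), qHalf q ^ 3 * x * z / α]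

/-- Denominator of the prefactor of the `₈W₇` in base `q`. -/
def lhsDen (q : ℝ) (β x z : ℂ) : ℂ :=
  qFactInfs q [-(qHalf q ^ 3 * x ^ 2 * z / β)]

/-- Parameters of the `₈W₇` in base `q²`. -/
def rhsParams (q : ℝ) (α β x z : ℂ) : Fin 6 → ℂ :=
  ![-(q * x ^ 2 * z ^ 2),
    q ^ 2 * x / (α * β), -(q * β * x / α), -(α * x / β), q * α * β * x, -(q * z ^ 2)]

/-- Argument of the `₈W₇` in base `q²`. -/
def rhsArg (q : ℝ) (z : ℂ) : ℂ := -(q * z ^ 2)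

/-- Numerator of the prefactor of the `₈W₇` in base `q²`. -/
def rhsNum (q : ℝ) (α β x z : ℂ) : ℂ :=
  qFactInfs ((q : ℂ) ^ 2)
    [-(q * α * β * x * z ^ 2), q ^ 2 * α * x * z ^ 2 / β,
      -(q ^ 2 * x * z ^ 2 / (α * β)), q ^ 3 * β * x * z ^ 2 / α]

/-- Denominator of the prefactor of the `₈W₇` in base `q²`. -/
def rhsDen (q : ℝ) (β x z : ℂ) : ℂ :=
  qFactInfs ((q : ℂ) ^ 2)
    [-(q ^ 3 * x ^ 2 * z ^ 2), -(q ^ 2 * z ^ 2), q ^ 2 * x ^ 2 * z ^ 2 / β ^ 2]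

end

/-! Both sides of (*) solve the same second-order q-difference equation in z, and that equation has
only one solution analytic at 0 with value 1 there.

The equation comes from one general series, ₈W₇(dZ; p₀, …, p₃, Z) in base q with d and p fixed.
After division by suitable infinite products its values at Z, qZ and q²Z satisfy a three-term
relation with polynomial coefficients (`normSum_contiguous`). The proof is creative telescoping:
term by term the combination is a difference in r, witnessed by the polynomial `cert` and checked in
`cert_identity`.

Both series in (*) are instances with d = x²: the left one has Z = -q^{1/2}z/β in base q, the right
one Z = -qz² in base q². In either case z ↦ qz multiplies Z by the base, and once the prefactors are
included the two relations coincide (`lhsQuad_equation`, `rhsQuad_equation`). The characteristic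
polynomial at z = 0 is (1 - u)(1 - x²u). Since q^n x² ≠ 1, no u = q^n with n ≥ 1 is a root, so the
difference of the two sides cannot have a zero of finite order at 0
(`eventually_eq_zero_of_qDifference`). The identity theorem carries the equality through the common
domain of convergence (`lhsQuad_eq_rhsQuad`), which gives (1).

For (2), the equation solved for the unshifted value continues the common function from a disc of
radius ρ to radius ρ/|q|, then ρ/|q|², and so on (`exists_meromorphic_extension`). The resulting
meromorphic M serves both sides, and dividing it by the two prefactors gives L and R
(`exists_meromorphicOn_quotient`). Throughout, h stands for q^{1/2}, so that all identities are
rational in h. -/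

noncomputable section

open Topology

/-! ### Polynomial data of the contiguous relation -/

/-- `∏_{i<j} (1 - t_i t_j X)` in terms of the elementary symmetric functions of `t₁, …, t₄`. -/
def pairPoly (τ₁ τ₂ τ₃ τ₄ X : ℂ) : ℂ :=
  1 - τ₂ * X + (τ₁ * τ₃ - τ₄) * X ^ 2 - (τ₃ ^ 2 + τ₁ ^ 2 * τ₄ - 2 * τ₂ * τ₄) * X ^ 3
    + τ₄ * (τ₁ * τ₃ - τ₄) * X ^ 4 - τ₂ * τ₄ ^ 2 * X ^ 5 + τ₄ ^ 3 * X ^ 6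

/-- The coefficient of `F (q² y)` in the contiguous relation. -/
def coeffUp (q d τ₁ τ₂ τ₃ τ₄ y : ℂ) : ℂ :=
  d * pairPoly τ₁ τ₂ τ₃ τ₄ (q ^ 2 * d * y) * (1 - d ^ 2 * τ₄ * q ^ 2 * y ^ 2)

/-- The coefficient of `F (q y)` in the contiguous relation. -/
def coeffMid (q d τ₁ τ₃ τ₄ y : ℂ) : ℂ :=
  (1 - d ^ 2 * τ₄ * q ^ 3 * y ^ 2) *
    (-(d + 1) + (q * d ^ 2 * τ₃ + d * τ₁) * (q * y)
      + (d ^ 2 * τ₄ * (1 + q ^ 2) * (d + 1)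
          - (1 + q) * (d ^ 2 * τ₃ + q * d ^ 3 * τ₁ * τ₄)) * (q * y) ^ 2
      + q * d ^ 2 * τ₄ * (q * d ^ 2 * τ₃ + d * τ₁) * (q * y) ^ 3
      - (q * d ^ 2 * τ₄) ^ 2 * (d + 1) * (q * y) ^ 4)

/-- The coefficient of `F y` in the contiguous relation. -/
def coeffDown (q d τ₄ y : ℂ) : ℂ :=
  (1 - y) * (1 - q ^ 2 * d ^ 2 * τ₄ * y) * (1 - d ^ 2 * τ₄ * q ^ 4 * y ^ 2)

/-- The polynomial certificate of the telescoping proof of the contiguous relation. -/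
def cert (q d τ₁ τ₂ τ₃ τ₄ y u : ℂ) : ℂ :=
  -((1 - y) * (1 - d ^ 2 * τ₄ * q ^ 4 * y ^ 2)) * (1 + d ^ 6 * τ₄ ^ 2 * (q * y) ^ 6 * u ^ 4)
  + u * ((1 + d) * y + (q * d ^ 2 * τ₃ * q - d * τ₁) * q * y ^ 2
      + (-(d ^ 2 + d ^ 3) * τ₄ * (1 + q ^ 2) + d ^ 3 * τ₁ * τ₄ * (q - q ^ 3)) * q ^ 2 * y ^ 3
      + (d ^ 3 * τ₁ * τ₄ - d ^ 4 * τ₃ * τ₄) * q ^ 5 * y ^ 4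
      + (d ^ 4 + d ^ 5) * τ₄ ^ 2 * q ^ 6 * y ^ 5)
  + u ^ 2 * (-d * y ^ 2
      + (-q ^ 2 * d ^ 3 * τ₄ - q * (d ^ 2 + d ^ 3) * τ₃ + d ^ 2 * τ₂) * q ^ 2 * y ^ 3
      + (d ^ 3 * τ₄ * (1 + q ^ 2) - q ^ 2 * d ^ 4 * τ₂ * τ₄
          + q ^ 3 * (d ^ 3 + d ^ 4) * τ₁ * τ₄) * q ^ 2 * y ^ 4
      + (d ^ 5 * τ₄ ^ 2 * (q + q ^ 3) + (d ^ 4 + d ^ 5) * τ₃ * τ₄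
          - q * d ^ 4 * τ₂ * τ₄) * q ^ 5 * y ^ 5
      + (-d ^ 5 * τ₄ ^ 2 + q ^ 2 * d ^ 6 * τ₂ * τ₄ ^ 2
          - q * (d ^ 5 + d ^ 6) * τ₁ * τ₄ ^ 2) * q ^ 6 * y ^ 6
      - d ^ 7 * τ₄ ^ 3 * q ^ 10 * y ^ 7)
  + u ^ 3 * ((d ^ 3 + d ^ 4) * τ₄ * q ^ 4 * y ^ 4
      + (d ^ 5 * τ₃ * τ₄ - d ^ 4 * τ₁ * τ₄) * q ^ 5 * y ^ 5
      + (-(d ^ 5 + d ^ 6) * τ₄ ^ 2 * q * (1 + q ^ 2) + d ^ 5 * τ₃ * τ₄ * (q ^ 2 - 1)) * q ^ 5 * y ^ 6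
      + (d ^ 6 * τ₁ * τ₄ ^ 2 - q ^ 2 * d ^ 7 * τ₃ * τ₄ ^ 2) * q ^ 7 * y ^ 7
      + (d ^ 7 + d ^ 8) * τ₄ ^ 3 * q ^ 10 * y ^ 8)

/-- `∏ (1 - t_i v)` in terms of the elementary symmetric functions of `t₁, …, t₄`. -/
def quartic (τ₁ τ₂ τ₃ τ₄ v : ℂ) : ℂ :=
  1 - τ₁ * v + τ₂ * v ^ 2 - τ₃ * v ^ 3 + τ₄ * v ^ 4

-- The telescoping identity with its common transcendental factor removed and u standing for q^r. As
-- u is a free variable, the whole contiguous relation reduces to an identity of polynomials.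
set_option maxHeartbeats 4000000 in
theorem cert_identity (q d τ₁ τ₂ τ₃ τ₄ y u : ℂ) :
    coeffUp q d τ₁ τ₂ τ₃ τ₄ y * (1 - d * q ^ 2 * y * u ^ 2) * u ^ 2 *
        ((1 - d * q * y * u) * (1 - q * y * u) * (1 - d * y * u) * (1 - y * u))
      + coeffMid q d τ₁ τ₃ τ₄ y * (1 - d * q * y * u ^ 2) * u *
        (quartic τ₁ τ₂ τ₃ τ₄ (q ^ 2 * d * y * u) * (1 - d * y * u) * (1 - y * u))
      + coeffDown q d τ₄ y * (1 - d * y * u ^ 2) *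
        (quartic τ₁ τ₂ τ₃ τ₄ (q * d * y * u) * quartic τ₁ τ₂ τ₃ τ₄ (q ^ 2 * d * y * u))
    = cert q d τ₁ τ₂ τ₃ τ₄ y (q * u) * (q ^ 2 * d ^ 2 * y) *
        (τ₄ - τ₃ * u + τ₂ * u ^ 2 - τ₁ * u ^ 3 + u ^ 4) * (1 - d * y * u) * (1 - y * u)
      - cert q d τ₁ τ₂ τ₃ τ₄ y u * (1 - u) * (1 - d * u) *
        quartic τ₁ τ₂ τ₃ τ₄ (q ^ 2 * d * y * u) := by
  unfold coeffUp coeffMid coeffDown cert quartic pairPoly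
  ring

/-! ### Finite and infinite q-shifted factorials -/

section QFactorial

theorem qFact_zero (q a : ℂ) : qFact q a 0 = 1 := by simp [qFact]

theorem qFact_succ (q a : ℂ) (r : ℕ) : qFact q a (r + 1) = qFact q a r * (1 - a * q ^ r) :=
  Finset.prod_range_succ _ _

theorem qFact_ne_zero {q a : ℂ} (h : ∀ n : ℕ, a * q ^ n ≠ 1) (r : ℕ) : qFact q a r ≠ 0 :=
  Finset.prod_ne_zero_iff.2 fun i _ => sub_ne_zero.2 (h i).symm

theorem differentiable_qFact (q : ℂ) (r : ℕ) : Differentiable ℂ fun a => qFact q a r := by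
  unfold qFact
  fun_prop

theorem qFactInf_zero (q : ℂ) : qFactInf q 0 = 1 := by simp [qFactInf]

variable {q : ℂ}

theorem summable_norm_neg_mul_pow (hq : ‖q‖ < 1) (a : ℂ) :
    Summable fun i : ℕ => ‖-(a * q ^ i)‖ := by
  simpa using (summable_geometric_of_lt_one (norm_nonneg _) hq).mul_left ‖a‖

theorem multipliable_one_sub_mul_pow (hq : ‖q‖ < 1) (a : ℂ) :
    Multipliable fun i : ℕ => 1 - a * q ^ i := by
  simpa [sub_eq_add_neg] using multipliable_one_add_of_summable (summable_norm_neg_mul_pow hq a)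

theorem qFactInf_eq_mul (hq : ‖q‖ < 1) (a : ℂ) :
    qFactInf q a = (1 - a) * qFactInf q (a * q) := by
  have h := multipliable_one_sub_mul_pow hq (a * q)
  unfold qFactInf
  rw [tprod_eq_zero_mul' (by simpa [pow_succ', mul_assoc] using h)]
  simp [pow_succ', mul_assoc]

theorem qFactInf_eq_qFact_mul (hq : ‖q‖ < 1) (a : ℂ) (r : ℕ) :
    qFactInf q a = qFact q a r * qFactInf q (a * q ^ r) := by
  induction r with
  | zero => simp [qFact_zero]
  | succ r ih =>
    rw [ih, qFact_succ, qFactInf_eq_mul hq (a * q ^ r), pow_succ]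
    ring_nf

theorem qFactInf_ne_zero (hq : ‖q‖ < 1) {a : ℂ} (h : ∀ n : ℕ, a * q ^ n ≠ 1) :
    qFactInf q a ≠ 0 := by
  have := tprod_one_add_ne_zero_of_summable (f := fun i : ℕ => -(a * q ^ i))
    (fun i => by rw [← sub_eq_add_neg]; exact sub_ne_zero.2 (h i).symm)
    (summable_norm_neg_mul_pow hq a)
  simpa [qFactInf, sub_eq_add_neg] using this

theorem mul_pow_ne_one (hq : ‖q‖ < 1) {a : ℂ} (ha : ‖a‖ < 1) (n : ℕ) : a * q ^ n ≠ 1 := by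
  intro h
  have h1 : ‖a * q ^ n‖ = 1 := by rw [h, norm_one]
  rw [norm_mul, norm_pow] at h1
  have h2 : ‖q‖ ^ n ≤ 1 := pow_le_one₀ (norm_nonneg _) hq.le
  nlinarith [norm_nonneg a, pow_nonneg (norm_nonneg q) n]

theorem qFactInf_ne_zero_of_norm_lt (hq : ‖q‖ < 1) {a : ℂ} (ha : ‖a‖ < 1) : qFactInf q a ≠ 0 :=
  qFactInf_ne_zero hq (mul_pow_ne_one hq ha)

theorem tendsto_qFact (hq : ‖q‖ < 1) (a : ℂ) :
    Tendsto (qFact q a) atTop (𝓝 (qFactInf q a)) :=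
  (multipliable_one_sub_mul_pow hq a).hasProd.tendsto_prod_nat

theorem differentiable_qFactInf (hq : ‖q‖ < 1) : Differentiable ℂ (qFactInf q) := by
  intro a
  have hU : IsOpen (Metric.ball (0 : ℂ) (‖a‖ + 1)) := Metric.isOpen_ball
  have hprod : HasProdLocallyUniformlyOn (fun (i : ℕ) (b : ℂ) => 1 + -(b * q ^ i))
      (fun b => ∏' i : ℕ, (1 + -(b * q ^ i))) (Metric.ball (0 : ℂ) (‖a‖ + 1)) := by
    refine ((summable_geometric_of_lt_one (norm_nonneg _) hq).mul_left
      (‖a‖ + 1)).hasProdLocallyUniformlyOn_nat_one_add hU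
      (.of_forall fun n b hb => ?_) (fun n => by fun_prop)
    rw [norm_neg, norm_mul, norm_pow]
    have : ‖b‖ < ‖a‖ + 1 := by simpa using hb
    gcongr
  have hd := hprod.differentiableOn (.of_forall fun s => by
    simpa [Finset.prod_fn] using DifferentiableOn.finsetProd (fun _ _ => by fun_prop)) hU
  have h2 := hd.differentiableAt (hU.mem_nhds (show a ∈ _ by simp))
  have h3 : qFactInf q = fun b => ∏' i : ℕ, (1 + -(b * q ^ i)) := by
    funext b
    simp only [qFactInf, sub_eq_add_neg]
  rw [h3]
  exact h2

theorem continuous_qFactInf (hq : ‖q‖ < 1) : Continuous (qFactInf q) :=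
  (differentiable_qFactInf hq).continuous

theorem exists_norm_qFactInf_le (hq : ‖q‖ < 1) (R : ℝ) :
    ∃ M : ℝ, 0 ≤ M ∧ ∀ a : ℂ, ‖a‖ ≤ R → ‖qFactInf q a‖ ≤ M := by
  obtain ⟨M, hM⟩ := (isCompact_closedBall (0 : ℂ) R).exists_bound_of_continuousOn
    (continuous_qFactInf hq).continuousOn
  exact ⟨max M 0, le_max_right _ _, fun a ha => (hM a (by simpa using ha)).trans (le_max_left _ _)⟩

/-- Each factor is at most exp(R‖q‖^i) and the exponents are summable. Uniformity in r is what the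
geometric majorant of the series needs. -/
theorem exists_norm_qFact_le (hq : ‖q‖ < 1) (R : ℝ) :
    ∃ M : ℝ, 0 ≤ M ∧ ∀ (a : ℂ) (r : ℕ), ‖a‖ ≤ R → ‖qFact q a r‖ ≤ M := by
  have hs := (summable_geometric_of_lt_one (norm_nonneg _) hq).mul_left R
  refine ⟨Real.exp (∑' i : ℕ, R * ‖q‖ ^ i), (Real.exp_pos _).le, fun a r ha => ?_⟩
  have hR : 0 ≤ R := (norm_nonneg a).trans ha
  calc ‖qFact q a r‖ = ∏ i ∈ Finset.range r, ‖1 - a * q ^ i‖ := norm_prod _ _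
    _ ≤ ∏ i ∈ Finset.range r, Real.exp (R * ‖q‖ ^ i) := by
        refine Finset.prod_le_prod (fun _ _ => norm_nonneg _) fun i _ => ?_
        have h1 : ‖a * q ^ i‖ ≤ R * ‖q‖ ^ i := by
          rw [norm_mul, norm_pow]
          gcongr
        have h2 := norm_sub_le 1 (a * q ^ i)
        rw [norm_one] at h2
        linarith [Real.add_one_le_exp (R * ‖q‖ ^ i)]
    _ = Real.exp (∑ i ∈ Finset.range r, R * ‖q‖ ^ i) := (Real.exp_sum _ _).symm
    _ ≤ _ := Real.exp_le_exp.2 (hs.sum_le_tsum _ fun i _ => by positivity)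

end QFactorial

/-! ### The general series with its Z-dependent denominators cleared -/

section GeneralSeries

/-- The parameters of `₈W₇(dZ; p₀, p₁, p₂, p₃, Z)`. -/
def vwpParams (d : ℂ) (p : Fin 4 → ℂ) (Z : ℂ) : Fin 6 → ℂ :=
  ![d * Z, p 0, p 1, p 2, p 3, Z]

/-- The argument of the very-well-poised series `₈W₇(dZ; p₀, p₁, p₂, p₃, Z)` is
`vwpScale q d p * Z`. -/
def vwpScale (q d : ℂ) (p : Fin 4 → ℂ) : ℂ := q ^ 2 * d ^ 2 * ∏ i, (p i)⁻¹

/-- The part of the `r`-th term of the series which does not depend on `Z`. -/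
def vwpCoeff (q d : ℂ) (p : Fin 4 → ℂ) (r : ℕ) : ℂ :=
  (∏ i, qFact q (p i) r) / (qFact q q r * qFact q (q * d) r)

/-- The `r`-th term of the series multiplied by its denominators depending on `Z`. -/
def regTerm (q d : ℂ) (p : Fin 4 → ℂ) (r : ℕ) (Z : ℂ) : ℂ :=
  (1 - d * Z * q ^ (2 * r)) * (vwpScale q d p * Z) ^ r * vwpCoeff q d p r *
    (qFact q (d * Z) r * qFact q Z r) * ∏ i, qFactInf q (q * d * Z / p i * q ^ r)

/-- The regularized series. -/
def regSum (q d : ℂ) (p : Fin 4 → ℂ) (Z : ℂ) : ℂ := ∑' r, regTerm q d p r Z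

variable {q d : ℂ} {p : Fin 4 → ℂ}

theorem self_mul_pow_ne_one (hq : ‖q‖ < 1) (n : ℕ) : q * q ^ n ≠ 1 := mul_pow_ne_one hq hq n

theorem tendsto_vwpCoeff (hq : ‖q‖ < 1) (hd : ∀ n : ℕ, q * d * q ^ n ≠ 1) (p : Fin 4 → ℂ) :
    Tendsto (vwpCoeff q d p) atTop
      (𝓝 ((∏ i, qFactInf q (p i)) / (qFactInf q q * qFactInf q (q * d)))) :=
  (tendsto_finsetProd _ fun i _ => tendsto_qFact hq (p i)).div
    ((tendsto_qFact hq q).mul (tendsto_qFact hq (q * d)))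
    (mul_ne_zero (qFactInf_ne_zero hq (self_mul_pow_ne_one hq)) (qFactInf_ne_zero hq hd))

theorem vwpCoeff_succ (hq : ‖q‖ < 1) (hd : ∀ n : ℕ, q * d * q ^ n ≠ 1) (p : Fin 4 → ℂ) (r : ℕ) :
    vwpCoeff q d p (r + 1) * ((1 - q * q ^ r) * (1 - q * d * q ^ r)) =
      vwpCoeff q d p r * ∏ i, (1 - p i * q ^ r) := by
  have h1 := sub_ne_zero.2 (self_mul_pow_ne_one hq r).symm
  have h2 := sub_ne_zero.2 (hd r).symm
  have h3 := qFact_ne_zero (self_mul_pow_ne_one hq) r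
  have h4 := qFact_ne_zero hd r
  simp only [vwpCoeff, qFact_succ, Finset.prod_mul_distrib]
  generalize (∏ i, (1 - p i * q ^ r)) = P
  generalize 1 - q * q ^ r = A at *
  generalize 1 - q * d * q ^ r = B at *
  field_simp

/-- Apart from the r-th power of the argument, every factor of the term is bounded uniformly in r
and in ‖Z‖ ≤ R; the coefficients are bounded because they converge. -/
theorem exists_norm_regTerm_le (hq : ‖q‖ < 1) (hd : ∀ n : ℕ, q * d * q ^ n ≠ 1)
    (p : Fin 4 → ℂ) (R : ℝ) :
    ∃ M : ℝ, 0 ≤ M ∧ ∀ (r : ℕ) (Z : ℂ), ‖Z‖ ≤ R →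
      ‖regTerm q d p r Z‖ ≤ M * ‖vwpScale q d p * Z‖ ^ r := by
  obtain ⟨Mc, hMc⟩ := (tendsto_vwpCoeff hq hd p).norm.bddAbove_range
  have hMc' : ∀ r, ‖vwpCoeff q d p r‖ ≤ Mc := fun r => hMc ⟨r, rfl⟩
  have hMc0 : 0 ≤ Mc := (norm_nonneg _).trans (hMc' 0)
  obtain ⟨M1, hM1, h1⟩ := exists_norm_qFact_le hq (‖d‖ * R)
  obtain ⟨M2, hM2, h2⟩ := exists_norm_qFact_le hq R
  choose M3 hM3 h3 using fun i => exists_norm_qFactInf_le hq (‖q * d / p i‖ * R)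
  -- `|R|` keeps the constant nonnegative when R < 0, where the bound itself is vacuous.
  refine ⟨(1 + ‖d‖ * |R|) * Mc * (M1 * M2) * ∏ i, M3 i,
    mul_nonneg (by positivity) (Finset.prod_nonneg fun i _ => hM3 i), fun r Z hZ => ?_⟩
  have hR : 0 ≤ R := (norm_nonneg Z).trans hZ
  have hq' : ∀ n, ‖q‖ ^ n ≤ 1 := fun n => pow_le_one₀ (norm_nonneg _) hq.le
  have e1 : ‖1 - d * Z * q ^ (2 * r)‖ ≤ 1 + ‖d‖ * |R| := by
    refine (norm_sub_le _ _).trans ?_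
    rw [norm_one, norm_mul, norm_mul, norm_pow, abs_of_nonneg hR]
    have : ‖d‖ * ‖Z‖ * ‖q‖ ^ (2 * r) ≤ ‖d‖ * R * 1 := by
      gcongr
      exact hq' _
    linarith
  have e2 : ‖qFact q (d * Z) r‖ ≤ M1 := h1 _ _ (by rw [norm_mul]; gcongr)
  have e3 : ‖qFact q Z r‖ ≤ M2 := h2 _ _ hZ
  have e4 : ‖∏ i, qFactInf q (q * d * Z / p i * q ^ r)‖ ≤ ∏ i, M3 i := by
    rw [norm_prod]
    refine Finset.prod_le_prod (fun _ _ => norm_nonneg _) fun i _ => h3 i _ ?_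
    rw [show q * d * Z / p i * q ^ r = q * d / p i * Z * q ^ r by ring, norm_mul, norm_mul, norm_pow]
    calc ‖q * d / p i‖ * ‖Z‖ * ‖q‖ ^ r ≤ ‖q * d / p i‖ * R * 1 := by
          gcongr
          exact hq' _
      _ = _ := mul_one _
  have e5 := hMc' r
  calc ‖regTerm q d p r Z‖
      = ‖1 - d * Z * q ^ (2 * r)‖ * ‖vwpScale q d p * Z‖ ^ r * ‖vwpCoeff q d p r‖ *
        (‖qFact q (d * Z) r‖ * ‖qFact q Z r‖) *
          ‖∏ i, qFactInf q (q * d * Z / p i * q ^ r)‖ := by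
        simp only [regTerm, norm_mul, norm_pow]
    _ ≤ (1 + ‖d‖ * |R|) * ‖vwpScale q d p * Z‖ ^ r * Mc * (M1 * M2) * ∏ i, M3 i := by
        gcongr
    _ = _ := by ring

theorem summable_regTerm (hq : ‖q‖ < 1) (hd : ∀ n : ℕ, q * d * q ^ n ≠ 1) {Z : ℂ}
    (hZ : ‖vwpScale q d p * Z‖ < 1) : Summable fun r => regTerm q d p r Z := by
  obtain ⟨M, -, hM⟩ := exists_norm_regTerm_le hq hd p ‖Z‖
  exact Summable.of_norm_bounded
    ((summable_geometric_of_lt_one (norm_nonneg _) hZ).mul_left M) fun r => hM r Z le_rfl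

theorem differentiable_regTerm (hq : ‖q‖ < 1) (r : ℕ) : Differentiable ℂ (regTerm q d p r) := by
  have h1 : Differentiable ℂ fun Z => qFact q (d * Z) r :=
    (differentiable_qFact q r).comp (by fun_prop)
  have h2 := differentiable_qFact q r
  have h3 : ∀ i, Differentiable ℂ fun Z => qFactInf q (q * d * Z / p i * q ^ r) := fun i =>
    (differentiable_qFactInf hq).comp (by fun_prop)
  have h4 : Differentiable ℂ fun Z => ∏ i, qFactInf q (q * d * Z / p i * q ^ r) :=
    Differentiable.fun_finsetProd fun i _ => h3 i
  unfold regTerm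
  fun_prop

theorem differentiableAt_regSum (hq : ‖q‖ < 1) (hd : ∀ n : ℕ, q * d * q ^ n ≠ 1) {Z : ℂ}
    (hZ : ‖vwpScale q d p * Z‖ < 1) : DifferentiableAt ℂ (regSum q d p) Z := by
  -- A ratio strictly between leaves room for a neighbourhood of Z with one common geometric
  -- majorant.
  obtain ⟨ρ, hρ1, hρ2⟩ := exists_between hZ
  have hρ0 : 0 ≤ ρ := (norm_nonneg _).trans hρ1.le
  obtain ⟨M, hM0, hM⟩ := exists_norm_regTerm_le hq hd p (‖Z‖ + 1)
  have hU : IsOpen {Y : ℂ | ‖vwpScale q d p * Y‖ < ρ ∧ ‖Y‖ < ‖Z‖ + 1} :=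
    (isOpen_lt (f := fun Y : ℂ => ‖vwpScale q d p * Y‖) (g := fun _ => ρ)
      (by fun_prop) (by fun_prop)).inter
      (isOpen_lt (f := fun Y : ℂ => ‖Y‖) (g := fun _ => ‖Z‖ + 1) (by fun_prop) (by fun_prop))
  have := Complex.differentiableOn_tsum_of_summable_norm (F := fun r Y => regTerm q d p r Y)
    ((summable_geometric_of_lt_one hρ0 hρ2).mul_left M)
    (fun r => (differentiable_regTerm hq r).differentiableOn) hU (fun r Y hY => by
      refine (hM r Y hY.2.le).trans ?_
      gcongr
      exact hY.1.le)
  exact this.differentiableAt (hU.mem_nhds ⟨hρ1, by simp⟩)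

theorem regSum_zero : regSum q d p 0 = 1 := by
  rw [regSum, tsum_eq_single 0 fun r hr => by simp [regTerm, hr]]
  simp [regTerm, vwpCoeff, qFact_zero, qFactInf_zero]

/-- The splitting (a; q)_∞ = (a; q)_r (aq^r; q)_∞ lets the infinite products absorb the four
denominators that depend on Z. -/
theorem vwpTerm_mul (hq : ‖q‖ < 1) (hd0 : d ≠ 0) {Z : ℂ} (hZ : Z ≠ 0)
    (hgen : VWPGeneric (vwpParams d p Z) q) (r : ℕ) :
    vwpTerm (vwpParams d p Z) q (vwpScale q d p * Z) r *
      ((1 - d * Z) * ∏ i, qFactInf q (q * d * Z / p i)) = regTerm q d p r Z := by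
  obtain ⟨h0, hgen⟩ := hgen
  have h1 : 1 - d * Z ≠ 0 := sub_ne_zero.2 (by simpa [vwpParams] using h0.symm)
  have hp : ∀ i, ∀ n : ℕ, q * d * Z / p i * q ^ n ≠ 1 := by
    intro i n
    rw [mul_assoc q d Z]
    fin_cases i
    exacts [hgen 1 n, hgen 2 n, hgen 3 n, hgen 4 n]
  have hne : ∀ i, qFact q (q * d * Z / p i) r ≠ 0 := fun i => qFact_ne_zero (hp i) r
  have e : ∀ i, qFactInf q (q * d * Z / p i) = qFact q (q * d * Z / p i) r *
      qFactInf q (q * d * Z / p i * q ^ r) := fun i => qFactInf_eq_qFact_mul hq _ r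
  -- The denominators paired with the parameters dZ and Z do not involve Z; this is why they sit in
  -- `vwpCoeff`.
  have hda : q * (d * Z) / (d * Z) = q := by field_simp
  have hdb : q * (d * Z) / Z = q * d := by field_simp
  simp only [vwpTerm, regTerm, vwpCoeff, e, Finset.prod_mul_distrib, Fin.prod_univ_six,
    Fin.prod_univ_four]
  simp only [vwpParams, Matrix.cons_val_zero, Matrix.cons_val_one, Matrix.cons_val, hda, hdb]
  have n0 := hne 0
  have n1 := hne 1
  have n2 := hne 2
  have n3 := hne 3
  clear e hne hp hgen
  rw [← mul_assoc q d Z]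
  simp only [div_eq_mul_inv _ (_ * _), div_eq_mul_inv (qFact q _ r) _, mul_inv,
    div_eq_mul_inv _ (1 - d * Z)]
  generalize qFact q (q * d) r = x4
  generalize qFact q q r = x5
  generalize x4⁻¹ = y4
  generalize x5⁻¹ = y5
  generalize qFactInf q (q * d * Z / p 0 * q ^ r) = i0
  generalize qFactInf q (q * d * Z / p 1 * q ^ r) = i1
  generalize qFactInf q (q * d * Z / p 2 * q ^ r) = i2
  generalize qFactInf q (q * d * Z / p 3 * q ^ r) = i3
  generalize qFact q (q * d * Z / p 0) r = x0 at *
  generalize qFact q (q * d * Z / p 1) r = x1 at *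
  generalize qFact q (q * d * Z / p 2) r = x2 at *
  generalize qFact q (q * d * Z / p 3) r = x3 at *
  generalize 1 - d * Z = D at *
  generalize (vwpScale q d p * Z) ^ r = W
  generalize 1 - d * Z * q ^ (2 * r) = V
  generalize qFact q (d * Z) r = f0
  generalize qFact q Z r = f1
  generalize qFact q (p 0) r = f2
  generalize qFact q (p 1) r = f3
  generalize qFact q (p 2) r = f4
  generalize qFact q (p 3) r = f5
  calc _ = V * W * (f2 * f3 * f4 * f5 * (y5 * y4)) * (f0 * f1) * (i0 * i1 * i2 * i3) *
        ((D⁻¹ * D) * (x0⁻¹ * x0) * (x1⁻¹ * x1) * (x2⁻¹ * x2) * (x3⁻¹ * x3)) := by ring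
    _ = _ := by simp only [inv_mul_cancel₀ h1, inv_mul_cancel₀ n0, inv_mul_cancel₀ n1,
          inv_mul_cancel₀ n2, inv_mul_cancel₀ n3, mul_one]

end GeneralSeries

/-! ### The contiguous relation by creative telescoping -/

section ContiguousRelation

variable {q d : ℂ} {p : Fin 4 → ℂ}

theorem VWPGeneric.qFactInf_ne_zero {Z : ℂ} (hq : ‖q‖ < 1)
    (hgen : VWPGeneric (vwpParams d p Z) q) (i : Fin 4) :
    qFactInf q (q * d * Z / p i) ≠ 0 := by
  refine _root_.qFactInf_ne_zero hq fun n => ?_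
  rw [mul_assoc q d Z]
  fin_cases i
  exacts [hgen.2 1 n, hgen.2 2 n, hgen.2 3 n, hgen.2 4 n]

theorem VWPGeneric.regFactor_ne_zero {Z : ℂ} (hq : ‖q‖ < 1)
    (hgen : VWPGeneric (vwpParams d p Z) q) :
    (1 - d * Z) * ∏ i, qFactInf q (q * d * Z / p i) ≠ 0 :=
  mul_ne_zero (sub_ne_zero.2 (by simpa [vwpParams] using hgen.1.symm))
    (Finset.prod_ne_zero_iff.2 fun i _ => hgen.qFactInf_ne_zero hq i)

theorem vwpTerm_eq (hq : ‖q‖ < 1) (hd0 : d ≠ 0) {Z : ℂ} (hZ : Z ≠ 0)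
    (hgen : VWPGeneric (vwpParams d p Z) q) (r : ℕ) :
    vwpTerm (vwpParams d p Z) q (vwpScale q d p * Z) r =
      regTerm q d p r Z / ((1 - d * Z) * ∏ i, qFactInf q (q * d * Z / p i)) := by
  rw [eq_div_iff (hgen.regFactor_ne_zero hq), vwpTerm_mul hq hd0 hZ hgen]

theorem summable_vwpTerm (hq : ‖q‖ < 1) (hd0 : d ≠ 0) (hd : ∀ n : ℕ, q * d * q ^ n ≠ 1) {Z : ℂ}
    (hZ : Z ≠ 0) (hw : ‖vwpScale q d p * Z‖ < 1) (hgen : VWPGeneric (vwpParams d p Z) q) :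
    Summable (vwpTerm (vwpParams d p Z) q (vwpScale q d p * Z)) := by
  rw [funext (vwpTerm_eq hq hd0 hZ hgen)]
  exact (summable_regTerm hq hd hw).div_const _

theorem W87_eq (hq : ‖q‖ < 1) (hd0 : d ≠ 0) {Z : ℂ} (hZ : Z ≠ 0)
    (hgen : VWPGeneric (vwpParams d p Z) q) :
    W87 (vwpParams d p Z) q (vwpScale q d p * Z) =
      regSum q d p Z / ((1 - d * Z) * ∏ i, qFactInf q (q * d * Z / p i)) := by
  rw [W87, funext (vwpTerm_eq hq hd0 hZ hgen), tsum_div_const, regSum]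

/-- The first elementary symmetric function of the reciprocals of `p₀, …, p₃`. -/
def tau₁ (p : Fin 4 → ℂ) : ℂ := (p 0)⁻¹ + (p 1)⁻¹ + (p 2)⁻¹ + (p 3)⁻¹

/-- The second elementary symmetric function of the reciprocals of `p₀, …, p₃`. -/
def tau₂ (p : Fin 4 → ℂ) : ℂ :=
  (p 0)⁻¹ * (p 1)⁻¹ + (p 0)⁻¹ * (p 2)⁻¹ + (p 0)⁻¹ * (p 3)⁻¹ + (p 1)⁻¹ * (p 2)⁻¹ +
    (p 1)⁻¹ * (p 3)⁻¹ + (p 2)⁻¹ * (p 3)⁻¹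

/-- The third elementary symmetric function of the reciprocals of `p₀, …, p₃`. -/
def tau₃ (p : Fin 4 → ℂ) : ℂ :=
  (p 0)⁻¹ * (p 1)⁻¹ * (p 2)⁻¹ + (p 0)⁻¹ * (p 1)⁻¹ * (p 3)⁻¹ + (p 0)⁻¹ * (p 2)⁻¹ * (p 3)⁻¹ +
    (p 1)⁻¹ * (p 2)⁻¹ * (p 3)⁻¹

/-- The fourth elementary symmetric function of the reciprocals of `p₀, …, p₃`. -/
def tau₄ (p : Fin 4 → ℂ) : ℂ := (p 0)⁻¹ * (p 1)⁻¹ * (p 2)⁻¹ * (p 3)⁻¹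

theorem prod_one_sub_div (p : Fin 4 → ℂ) (v : ℂ) :
    ∏ i, (1 - v / p i) = quartic (tau₁ p) (tau₂ p) (tau₃ p) (tau₄ p) v := by
  simp only [Fin.prod_univ_four, quartic, tau₁, tau₂, tau₃, tau₄, div_eq_mul_inv]
  ring

theorem vwpScale_eq (q d : ℂ) (p : Fin 4 → ℂ) : vwpScale q d p = q ^ 2 * d ^ 2 * tau₄ p := by
  simp only [vwpScale, Fin.prod_univ_four, tau₄]

/-- Translates the ratio of consecutive coefficients `vwpCoeff` into the symmetric functions in
which `cert_identity` is written. -/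
theorem tau₄_mul_prod (hp : ∀ i, p i ≠ 0) (u : ℂ) :
    tau₄ p * ∏ i, (1 - p i * u) =
      tau₄ p - tau₃ p * u + tau₂ p * u ^ 2 - tau₁ p * u ^ 3 + u ^ 4 := by
  have h : ∏ i, (1 - p i * u) = (∏ i, p i) * ∏ i, ((p i)⁻¹ - u) := by
    rw [← Finset.prod_mul_distrib]
    exact Finset.prod_congr rfl fun i _ => by rw [mul_sub, mul_inv_cancel₀ (hp i)]
  have h2 : tau₄ p * ∏ i, p i = 1 := by
    have : tau₄ p = ∏ i, (p i)⁻¹ := by simp only [Fin.prod_univ_four, tau₄]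
    rw [this, ← Finset.prod_mul_distrib]
    exact Finset.prod_eq_one fun i _ => inv_mul_cancel₀ (hp i)
  rw [h, ← mul_assoc, h2]
  simp only [Fin.prod_univ_four, tau₁, tau₂, tau₃, tau₄]
  ring

/-- The sum of the series in the normalization for which the contiguous relation has polynomial
coefficients. -/
def normSum (q d : ℂ) (p : Fin 4 → ℂ) (Z : ℂ) : ℂ :=
  regSum q d p Z / (qFactInf q (d * Z) * qFactInf q Z)

/-- The terms of `normSum`. -/
def normTerm (q d : ℂ) (p : Fin 4 → ℂ) (r : ℕ) (Z : ℂ) : ℂ :=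
  regTerm q d p r Z / (qFactInf q (d * Z) * qFactInf q Z)

/-- The common factor of the terms at `y`, `q y` and `q² y`. -/
def telescopeFactor (q d : ℂ) (p : Fin 4 → ℂ) (y : ℂ) (r : ℕ) : ℂ :=
  (vwpScale q d p * y) ^ r * vwpCoeff q d p r *
    (∏ i, qFactInf q (q ^ 3 * d * y * q ^ r / p i)) /
      (qFactInf q (d * y * q ^ r) * qFactInf q (y * q ^ r))

/-- The normalization turns (dZ; q)_r and (Z; q)_r into reciprocals of infinite products at dZq^r
and Zq^r. All infinite products then depend on Z only through Zq^r, so a shift of Z changes them by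
finitely many factors. -/
theorem normTerm_eq (hq : ‖q‖ < 1) {Z : ℂ} (h1 : ‖Z‖ < 1) (h2 : ‖d * Z‖ < 1) (r : ℕ) :
    normTerm q d p r Z = (1 - d * Z * (q ^ r) ^ 2) * (vwpScale q d p * Z) ^ r * vwpCoeff q d p r *
      (∏ i, qFactInf q (q * d * Z * q ^ r / p i)) /
        (qFactInf q (d * Z * q ^ r) * qFactInf q (Z * q ^ r)) := by
  have e1 := qFactInf_eq_qFact_mul hq (d * Z) r
  have e2 := qFactInf_eq_qFact_mul hq Z r
  have n1 := qFactInf_ne_zero_of_norm_lt hq h2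
  have n2 := qFactInf_ne_zero_of_norm_lt hq h1
  rw [e1] at n1
  rw [e2] at n2
  rw [normTerm, regTerm, e1, e2, ← pow_mul, mul_comm r 2]
  have e3 : ∀ i, q * d * Z / p i * q ^ r = q * d * Z * q ^ r / p i := fun i => by ring
  simp only [e3]
  have m1 := left_ne_zero_of_mul n1
  have m2 := left_ne_zero_of_mul n2
  have m3 := right_ne_zero_of_mul n1
  have m4 := right_ne_zero_of_mul n2
  generalize (∏ i, qFactInf q (q * d * Z * q ^ r / p i)) = Γ
  generalize (1 - d * Z * q ^ (2 * r)) * (vwpScale q d p * Z) ^ r * vwpCoeff q d p r = A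
  field_simp

/-- The common factor takes its numerator from the term at q²y and its denominator from the term at
y. Here the numerator products start two steps earlier, which produces the two quartics. -/
theorem normTerm_down (hq : ‖q‖ < 1) {y : ℂ} (h1 : ‖y‖ < 1) (h2 : ‖d * y‖ < 1) (r : ℕ) :
    normTerm q d p r y = telescopeFactor q d p y r * ((1 - d * y * (q ^ r) ^ 2) *
      (quartic (tau₁ p) (tau₂ p) (tau₃ p) (tau₄ p) (q * d * y * q ^ r) *
        quartic (tau₁ p) (tau₂ p) (tau₃ p) (tau₄ p) (q ^ 2 * d * y * q ^ r))) := by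
  have e : ∀ i, qFactInf q (q * d * y * q ^ r / p i) = (1 - q * d * y * q ^ r / p i) *
      ((1 - q ^ 2 * d * y * q ^ r / p i) * qFactInf q (q ^ 3 * d * y * q ^ r / p i)) := fun i => by
    rw [qFactInf_eq_mul hq, qFactInf_eq_mul hq (q * d * y * q ^ r / p i * q)]
    ring_nf
  rw [normTerm_eq hq h1 h2, telescopeFactor]
  simp only [e, Finset.prod_mul_distrib, prod_one_sub_div]
  ring

theorem norm_mul_lt_one (hq : ‖q‖ < 1) {y : ℂ} (h : ‖y‖ < 1) : ‖q * y‖ < 1 := by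
  rw [norm_mul]
  nlinarith [norm_nonneg q, norm_nonneg y]

theorem qFactInf_mul_pow_ne_zero (hq : ‖q‖ < 1) {y : ℂ} (h : ‖y‖ < 1) (r : ℕ) :
    qFactInf q (y * q ^ r) ≠ 0 := by
  refine qFactInf_ne_zero hq fun n => ?_
  rw [mul_assoc, ← pow_add]
  exact mul_pow_ne_one hq h _

theorem normTerm_mid (hq : ‖q‖ < 1) {y : ℂ} (h1 : ‖y‖ < 1) (h2 : ‖d * y‖ < 1) (r : ℕ) :
    normTerm q d p r (q * y) = telescopeFactor q d p y r * ((1 - d * q * y * (q ^ r) ^ 2) * q ^ r *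
      (quartic (tau₁ p) (tau₂ p) (tau₃ p) (tau₄ p) (q ^ 2 * d * y * q ^ r) *
        (1 - d * y * q ^ r) * (1 - y * q ^ r))) := by
  have e : ∀ i, qFactInf q (q * d * (q * y) * q ^ r / p i) = (1 - q ^ 2 * d * y * q ^ r / p i) *
      qFactInf q (q ^ 3 * d * y * q ^ r / p i) := fun i => by
    rw [qFactInf_eq_mul hq]
    ring_nf
  have e1 : qFactInf q (d * y * q ^ r) =
      (1 - d * y * q ^ r) * qFactInf q (d * (q * y) * q ^ r) := by
    rw [qFactInf_eq_mul hq]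
    ring_nf
  have e2 : qFactInf q (y * q ^ r) = (1 - y * q ^ r) * qFactInf q (q * y * q ^ r) := by
    rw [qFactInf_eq_mul hq]
    ring_nf
  have n1 := qFactInf_mul_pow_ne_zero hq h1 r
  have n2 := qFactInf_mul_pow_ne_zero hq h2 r
  rw [normTerm_eq hq (norm_mul_lt_one hq h1) (by rw [mul_left_comm]; exact norm_mul_lt_one hq h2),
    telescopeFactor]
  rw [e1] at n2 ⊢
  rw [e2] at n1 ⊢
  simp only [e, Finset.prod_mul_distrib, prod_one_sub_div]
  have m1 := left_ne_zero_of_mul n1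
  have m2 := left_ne_zero_of_mul n2
  have m3 := right_ne_zero_of_mul n1
  have m4 := right_ne_zero_of_mul n2
  rw [show vwpScale q d p * (q * y) = q * (vwpScale q d p * y) by ring, mul_pow]
  generalize quartic (tau₁ p) (tau₂ p) (tau₃ p) (tau₄ p) (q ^ 2 * d * y * q ^ r) = Q
  generalize (∏ i, qFactInf q (q ^ 3 * d * y * q ^ r / p i)) = Γ
  generalize (vwpScale q d p * y) ^ r = W
  generalize qFactInf q (d * (q * y) * q ^ r) = X at *
  generalize qFactInf q (q * y * q ^ r) = Y at *
  generalize q ^ r = u at *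
  field_simp

theorem normTerm_up (hq : ‖q‖ < 1) {y : ℂ} (h1 : ‖y‖ < 1) (h2 : ‖d * y‖ < 1) (r : ℕ) :
    normTerm q d p r (q ^ 2 * y) = telescopeFactor q d p y r *
      ((1 - d * q ^ 2 * y * (q ^ r) ^ 2) * (q ^ r) ^ 2 *
        ((1 - d * q * y * q ^ r) * (1 - q * y * q ^ r) * (1 - d * y * q ^ r) *
          (1 - y * q ^ r))) := by
  have e1 : qFactInf q (d * y * q ^ r) =
      (1 - d * y * q ^ r) * ((1 - d * q * y * q ^ r) * qFactInf q (d * (q ^ 2 * y) * q ^ r)) := by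
    rw [qFactInf_eq_mul hq, qFactInf_eq_mul hq (_ * q)]
    ring_nf
  have e2 : qFactInf q (y * q ^ r) =
      (1 - y * q ^ r) * ((1 - q * y * q ^ r) * qFactInf q (q ^ 2 * y * q ^ r)) := by
    rw [qFactInf_eq_mul hq, qFactInf_eq_mul hq (_ * q)]
    ring_nf
  have e3 : ∀ i, q * d * (q ^ 2 * y) * q ^ r / p i = q ^ 3 * d * y * q ^ r / p i :=
    fun i => by ring
  have n1 := qFactInf_mul_pow_ne_zero hq h1 r
  have n2 := qFactInf_mul_pow_ne_zero hq h2 r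
  have h1' : ‖q ^ 2 * y‖ < 1 := by
    rw [pow_two, mul_assoc]
    exact norm_mul_lt_one hq (norm_mul_lt_one hq h1)
  have h2' : ‖d * (q ^ 2 * y)‖ < 1 := by
    rw [show d * (q ^ 2 * y) = q * (q * (d * y)) by ring]
    exact norm_mul_lt_one hq (norm_mul_lt_one hq h2)
  rw [normTerm_eq hq h1' h2', telescopeFactor]
  rw [e1] at n2 ⊢
  rw [e2] at n1 ⊢
  simp only [e3]
  have m1 := left_ne_zero_of_mul n1
  have m2 := left_ne_zero_of_mul n2
  have m3 := left_ne_zero_of_mul (right_ne_zero_of_mul n1)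
  have m4 := left_ne_zero_of_mul (right_ne_zero_of_mul n2)
  have m5 := right_ne_zero_of_mul (right_ne_zero_of_mul n1)
  have m6 := right_ne_zero_of_mul (right_ne_zero_of_mul n2)
  rw [show vwpScale q d p * (q ^ 2 * y) = q ^ 2 * (vwpScale q d p * y) by ring, mul_pow, pow_right_comm]
  generalize (∏ i, qFactInf q (q ^ 3 * d * y * q ^ r / p i)) = Γ
  generalize (vwpScale q d p * y) ^ r = W
  generalize qFactInf q (d * (q ^ 2 * y) * q ^ r) = X at *
  generalize qFactInf q (q ^ 2 * y * q ^ r) = Y at *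
  generalize q ^ r = u at *
  field_simp

/-- The telescoping sequence of the contiguous relation. -/
def telescope (q d : ℂ) (p : Fin 4 → ℂ) (y : ℂ) (r : ℕ) : ℂ :=
  telescopeFactor q d p y r * (cert q d (tau₁ p) (tau₂ p) (tau₃ p) (tau₄ p) y (q ^ r) *
    (1 - q ^ r) * (1 - d * q ^ r) *
      quartic (tau₁ p) (tau₂ p) (tau₃ p) (tau₄ p) (q ^ 2 * d * y * q ^ r))

/-- Passing from r to r + 1 multiplies the common factor by a rational function of q^r. Its
denominators cancel against the factors built into `telescope`, leaving the first term on the right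
of `cert_identity`. -/
theorem telescope_succ (hq : ‖q‖ < 1) (hd : ∀ n : ℕ, q * d * q ^ n ≠ 1) (hp : ∀ i, p i ≠ 0)
    {y : ℂ} (h1 : ‖y‖ < 1) (h2 : ‖d * y‖ < 1) (r : ℕ) :
    telescope q d p y (r + 1) = telescopeFactor q d p y r *
      (cert q d (tau₁ p) (tau₂ p) (tau₃ p) (tau₄ p) y (q * q ^ r) * (q ^ 2 * d ^ 2 * y) *
        (tau₄ p - tau₃ p * q ^ r + tau₂ p * (q ^ r) ^ 2 - tau₁ p * (q ^ r) ^ 3 + (q ^ r) ^ 4) *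
          (1 - d * y * q ^ r) * (1 - y * q ^ r)) := by
  have e : ∀ i, qFactInf q (q ^ 3 * d * y * q ^ r / p i) = (1 - q ^ 3 * d * y * q ^ r / p i) *
      qFactInf q (q ^ 3 * d * y * q ^ (r + 1) / p i) := fun i => by
    rw [qFactInf_eq_mul hq]
    ring_nf
  have e1 : qFactInf q (d * y * q ^ r) =
      (1 - d * y * q ^ r) * qFactInf q (d * y * q ^ (r + 1)) := by
    rw [qFactInf_eq_mul hq]
    ring_nf
  have e2 : qFactInf q (y * q ^ r) = (1 - y * q ^ r) * qFactInf q (y * q ^ (r + 1)) := by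
    rw [qFactInf_eq_mul hq]
    ring_nf
  have n1 := qFactInf_mul_pow_ne_zero hq h1 r
  have n2 := qFactInf_mul_pow_ne_zero hq h2 r
  have ec := vwpCoeff_succ hq hd p r
  rw [telescope, telescopeFactor, telescopeFactor, ← tau₄_mul_prod hp, ← pow_succ']
  rw [e1] at n2 ⊢
  rw [e2] at n1 ⊢
  simp only [e, Finset.prod_mul_distrib, prod_one_sub_div]
  have m1 := left_ne_zero_of_mul n1
  have m2 := left_ne_zero_of_mul n2
  have m3 := right_ne_zero_of_mul n1
  have m4 := right_ne_zero_of_mul n2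
  rw [show q ^ 2 * d * y * q ^ (r + 1) = q ^ 3 * d * y * q ^ r by ring]
  rw [show q * q ^ r = q ^ (r + 1) by ring, show q * d * q ^ r = d * q ^ (r + 1) by ring] at ec
  generalize quartic (tau₁ p) (tau₂ p) (tau₃ p) (tau₄ p) (q ^ 3 * d * y * q ^ r) = Q at *
  generalize (∏ i, qFactInf q (q ^ 3 * d * y * q ^ (r + 1) / p i)) = Γ at *
  generalize qFactInf q (d * y * q ^ (r + 1)) = X at *
  generalize qFactInf q (y * q ^ (r + 1)) = Y at *
  generalize cert q d (tau₁ p) (tau₂ p) (tau₃ p) (tau₄ p) y (q ^ (r + 1)) = K at *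
  generalize (∏ i, (1 - p i * q ^ r)) = P at *
  rw [pow_succ (vwpScale q d p * y)]
  generalize (vwpScale q d p * y) ^ r = W at *
  rw [vwpScale_eq]
  -- The factors 1 - q^{r+1} and 1 - dq^{r+1} are grouped with the coefficient so that its
  -- recurrence `vwpCoeff_succ` applies.
  calc _ = W * Γ * Q / (X * Y) * K * (q ^ 2 * d ^ 2 * tau₄ p * y) *
        (vwpCoeff q d p (r + 1) * ((1 - q ^ (r + 1)) * (1 - d * q ^ (r + 1)))) := by ring
    _ = _ := by
      rw [ec]
      generalize vwpCoeff q d p r = c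
      generalize 1 - d * y * q ^ r = A at *
      generalize 1 - y * q ^ r = B at *
      field_simp

theorem telescope_zero (q d : ℂ) (p : Fin 4 → ℂ) (y : ℂ) : telescope q d p y 0 = 0 := by
  simp [telescope]

/-- The r-th power of the argument tends to 0 while all other factors converge. -/
theorem tendsto_telescope (hq : ‖q‖ < 1) (hd : ∀ n : ℕ, q * d * q ^ n ≠ 1)
    {y : ℂ} (hw : ‖vwpScale q d p * y‖ < 1) :
    Tendsto (telescope q d p y) atTop (𝓝 0) := by
  have hu : Tendsto (fun r : ℕ => q ^ r) atTop (𝓝 0) := tendsto_pow_atTop_nhds_zero_of_norm_lt_one hq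
  have hW := tendsto_pow_atTop_nhds_zero_of_norm_lt_one hw
  have hc := tendsto_vwpCoeff hq hd p
  have hcont := continuous_qFactInf hq
  have hΓ : Tendsto (fun r : ℕ => ∏ i, qFactInf q (q ^ 3 * d * y * q ^ r / p i)) atTop (𝓝 1) := by
    have : Continuous fun u : ℂ => ∏ i, qFactInf q (q ^ 3 * d * y * u / p i) := by fun_prop
    simpa [qFactInf_zero, Function.comp_def] using (this.tendsto 0).comp hu
  have hΔ : Tendsto (fun r : ℕ => qFactInf q (d * y * q ^ r) * qFactInf q (y * q ^ r)) atTop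
      (𝓝 1) := by
    have : Continuous fun u : ℂ => qFactInf q (d * y * u) * qFactInf q (y * u) := by fun_prop
    simpa [qFactInf_zero, Function.comp_def] using (this.tendsto 0).comp hu
  have hR : Tendsto (fun r : ℕ => cert q d (tau₁ p) (tau₂ p) (tau₃ p) (tau₄ p) y (q ^ r) *
      (1 - q ^ r) * (1 - d * q ^ r) *
        quartic (tau₁ p) (tau₂ p) (tau₃ p) (tau₄ p) (q ^ 2 * d * y * q ^ r)) atTop
      (𝓝 (cert q d (tau₁ p) (tau₂ p) (tau₃ p) (tau₄ p) y 0 * (1 - 0) * (1 - d * 0) *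
        quartic (tau₁ p) (tau₂ p) (tau₃ p) (tau₄ p) (q ^ 2 * d * y * 0))) := by
    have : Continuous fun u : ℂ => cert q d (tau₁ p) (tau₂ p) (tau₃ p) (tau₄ p) y u *
      (1 - u) * (1 - d * u) *
        quartic (tau₁ p) (tau₂ p) (tau₃ p) (tau₄ p) (q ^ 2 * d * y * u) := by
      unfold cert quartic
      fun_prop
    exact (this.tendsto 0).comp hu
  have := (((hW.mul hc).mul hΓ).div hΔ one_ne_zero).mul hR
  rw [zero_mul, zero_mul, zero_div, zero_mul] at this
  exact this

theorem hasSum_normTerm (hq : ‖q‖ < 1) (hd : ∀ n : ℕ, q * d * q ^ n ≠ 1) {Z : ℂ}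
    (hw : ‖vwpScale q d p * Z‖ < 1) : HasSum (fun r => normTerm q d p r Z) (normSum q d p Z) :=
  (summable_regTerm hq hd hw).hasSum.div_const _

/-- The contiguous relation. -/
theorem normSum_contiguous (hq : ‖q‖ < 1) (hd : ∀ n : ℕ, q * d * q ^ n ≠ 1) (hp : ∀ i, p i ≠ 0)
    {y : ℂ} (h1 : ‖y‖ < 1) (h2 : ‖d * y‖ < 1) (hw : ‖vwpScale q d p * y‖ < 1) :
    coeffUp q d (tau₁ p) (tau₂ p) (tau₃ p) (tau₄ p) y * normSum q d p (q ^ 2 * y)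
      + coeffMid q d (tau₁ p) (tau₃ p) (tau₄ p) y * normSum q d p (q * y)
      + coeffDown q d (tau₄ p) y * normSum q d p y = 0 := by
  have hw1 : ‖vwpScale q d p * (q * y)‖ < 1 := by
    rw [mul_left_comm]
    exact norm_mul_lt_one hq hw
  have hw2 : ‖vwpScale q d p * (q ^ 2 * y)‖ < 1 := by
    rw [show vwpScale q d p * (q ^ 2 * y) = q * (q * (vwpScale q d p * y)) by ring]
    exact norm_mul_lt_one hq (norm_mul_lt_one hq hw)
  have hsum := (((hasSum_normTerm hq hd hw2).mul_left
    (coeffUp q d (tau₁ p) (tau₂ p) (tau₃ p) (tau₄ p) y)).add ((hasSum_normTerm hq hd hw1).mul_left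
    (coeffMid q d (tau₁ p) (tau₃ p) (tau₄ p) y))).add ((hasSum_normTerm hq hd hw).mul_left
    (coeffDown q d (tau₄ p) y))
  have hterm : ∀ r, coeffUp q d (tau₁ p) (tau₂ p) (tau₃ p) (tau₄ p) y *
      normTerm q d p r (q ^ 2 * y) + coeffMid q d (tau₁ p) (tau₃ p) (tau₄ p) y *
      normTerm q d p r (q * y) + coeffDown q d (tau₄ p) y * normTerm q d p r y =
      telescope q d p y (r + 1) - telescope q d p y r := fun r => by
    rw [normTerm_up hq h1 h2, normTerm_mid hq h1 h2, normTerm_down hq h1 h2,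
      telescope_succ hq hd hp h1 h2, telescope]
    linear_combination telescopeFactor q d p y r *
      cert_identity q d (tau₁ p) (tau₂ p) (tau₃ p) (tau₄ p) y (q ^ r)
  simp only [hterm] at hsum
  -- The partial sums collapse to the upper boundary term alone: the lower one vanishes through the
  -- factor 1 - q^r at r = 0.
  refine tendsto_nhds_unique hsum.tendsto_sum_nat ?_
  simp only [Finset.sum_range_sub, telescope_zero, sub_zero]
  exact tendsto_telescope hq hd hw

end ContiguousRelation

/-! ### Uniqueness and meromorphic continuation for q-difference equations -/

section Recurrence

/-- A function analytic at `0`, vanishing there and satisfying a second order `q`-difference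
equation, is zero if no positive integer is a characteristic exponent of the equation at `0`. -/
theorem eventually_eq_zero_of_qDifference {f A B C : ℂ → ℂ} {q : ℂ}
    (hf : AnalyticAt ℂ f 0) (hf0 : f 0 = 0) (hA : ContinuousAt A 0) (hB : ContinuousAt B 0)
    (hC : ContinuousAt C 0)
    (hrec : ∀ᶠ y in 𝓝 0, A y * f (q ^ 2 * y) + B y * f (q * y) + C y * f y = 0)
    (hne : ∀ n : ℕ, n ≠ 0 → A 0 * (q ^ n) ^ 2 + B 0 * q ^ n + C 0 ≠ 0) :
    ∀ᶠ y in 𝓝 0, f y = 0 := by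
  by_contra hcon
  -- A nonzero germ is y^n g(y) with g(0) ≠ 0, and n ≥ 1 because f(0) = 0. Dividing the equation by
  -- y^n and letting y → 0 makes q^n a characteristic root.
  obtain ⟨n, g, hg, hg0, hfg⟩ := hf.exists_eventuallyEq_pow_smul_nonzero_iff.2 hcon
  simp only [sub_zero, smul_eq_mul] at hfg
  have hn : n ≠ 0 := by
    rintro rfl
    have := hfg.self_of_nhds
    rw [hf0, pow_zero, one_mul] at this
    exact hg0 this.symm
  have t1 : Tendsto (fun y : ℂ => q * y) (𝓝 0) (𝓝 0) := by
    simpa using (continuous_const_mul q).tendsto (0 : ℂ)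
  have t2 : Tendsto (fun y : ℂ => q ^ 2 * y) (𝓝 0) (𝓝 0) := by
    simpa using (continuous_const_mul (q ^ 2)).tendsto (0 : ℂ)
  have hev : ∀ᶠ y in 𝓝[≠] (0 : ℂ),
      A y * (q ^ n) ^ 2 * g (q ^ 2 * y) + B y * q ^ n * g (q * y) + C y * g y = 0 := by
    filter_upwards [self_mem_nhdsWithin, hrec.filter_mono nhdsWithin_le_nhds,
      hfg.filter_mono nhdsWithin_le_nhds, (t1.eventually hfg).filter_mono nhdsWithin_le_nhds,
      (t2.eventually hfg).filter_mono nhdsWithin_le_nhds] with y hy h h0 h1 h2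
    rw [h0, h1, h2, mul_pow, mul_pow, pow_right_comm] at h
    refine (mul_eq_zero.1 (?_ : y ^ n * _ = 0)).resolve_left (pow_ne_zero n hy)
    linear_combination h
  have hlim : Tendsto (fun y => A y * (q ^ n) ^ 2 * g (q ^ 2 * y) + B y * q ^ n * g (q * y) +
      C y * g y) (𝓝 0) (𝓝 (A 0 * (q ^ n) ^ 2 * g 0 + B 0 * q ^ n * g 0 + C 0 * g 0)) :=
    (((hA.tendsto.mul_const _).mul (hg.continuousAt.tendsto.comp t2)).add
      ((hB.tendsto.mul_const _).mul (hg.continuousAt.tendsto.comp t1))).add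
      (hC.tendsto.mul hg.continuousAt.tendsto)
  have h0 := tendsto_nhds_unique_of_eventuallyEq (hlim.mono_left nhdsWithin_le_nhds)
    tendsto_const_nhds hev
  refine mul_ne_zero (hne n hn) hg0 ?_
  linear_combination h0

/-- The `n`-fold application of the recurrence `g ↦ (y ↦ P y * g (q y) + Q y * g (q² y))`. -/
def qExtend (q : ℂ) (P Q f : ℂ → ℂ) : ℕ → ℂ → ℂ
  | 0 => f
  | n + 1 => fun y => P y * qExtend q P Q f n (q * y) + Q y * qExtend q P Q f n (q ^ 2 * y)

variable {q : ℂ} {P Q f : ℂ → ℂ} {ρ : ℝ}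

theorem pow_mul_norm_lt_of_succ (hq : ‖q‖ < 1) {n : ℕ} {y : ℂ}
    (hy : ‖q‖ ^ (n + 1) * ‖y‖ < ρ) :
    ‖q‖ ^ n * ‖q * y‖ < ρ ∧ ‖q‖ ^ n * ‖q ^ 2 * y‖ < ρ := by
  have h1 : ‖q‖ ^ n * ‖q * y‖ = ‖q‖ ^ (n + 1) * ‖y‖ := by
    rw [norm_mul, pow_succ, mul_assoc]
  refine ⟨h1.trans_lt hy, lt_of_le_of_lt ?_ hy⟩
  rw [← h1, pow_two, mul_assoc, norm_mul q (q * y)]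
  have : ‖q‖ * ‖q * y‖ ≤ 1 * ‖q * y‖ := by gcongr
  rw [one_mul] at this
  gcongr

/-- Each application of the recurrence evaluates only at qy and q²y, so it enlarges the disc of
meromorphy by the factor 1/‖q‖. -/
theorem meromorphicAt_qExtend (hq : ‖q‖ < 1) (hP : Meromorphic P) (hQ : Meromorphic Q)
    (hf : ∀ y, ‖y‖ < ρ → MeromorphicAt f y) (n : ℕ) :
    ∀ y, ‖q‖ ^ n * ‖y‖ < ρ → MeromorphicAt (qExtend q P Q f n) y := by
  induction n with
  | zero => exact fun y hy => hf y (by simpa using hy)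
  | succ n ih =>
    intro y hy
    obtain ⟨h1, h2⟩ := pow_mul_norm_lt_of_succ hq hy
    have a1 : AnalyticAt ℂ (fun y => q * y) y := by fun_prop
    have a2 : AnalyticAt ℂ (fun y => q ^ 2 * y) y := by fun_prop
    exact ((hP y).mul ((ih _ h1).comp_analyticAt a1)).add ((hQ y).mul ((ih _ h2).comp_analyticAt a2))

theorem qExtend_succ_eq (hq : ‖q‖ < 1)
    (hrec : ∀ y, ‖y‖ < ρ → f y = P y * f (q * y) + Q y * f (q ^ 2 * y)) (n : ℕ) :
    ∀ y, ‖q‖ ^ n * ‖y‖ < ρ → qExtend q P Q f (n + 1) y = qExtend q P Q f n y := by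
  induction n with
  | zero => exact fun y hy => (hrec y (by simpa using hy)).symm
  | succ n ih =>
    intro y hy
    obtain ⟨h1, h2⟩ := pow_mul_norm_lt_of_succ hq hy
    change P y * qExtend q P Q f (n + 1) (q * y) + Q y * qExtend q P Q f (n + 1) (q ^ 2 * y) =
      P y * qExtend q P Q f n (q * y) + Q y * qExtend q P Q f n (q ^ 2 * y)
    rw [ih _ h1, ih _ h2]

theorem qExtend_eq_of_le (hq : ‖q‖ < 1)
    (hrec : ∀ y, ‖y‖ < ρ → f y = P y * f (q * y) + Q y * f (q ^ 2 * y)) {n m : ℕ} (hnm : n ≤ m)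
    {y : ℂ} (hy : ‖q‖ ^ n * ‖y‖ < ρ) : qExtend q P Q f m y = qExtend q P Q f n y := by
  induction m, hnm using Nat.le_induction with
  | base => rfl
  | succ m hm ih =>
    rw [qExtend_succ_eq hq hrec m y, ih]
    refine lt_of_le_of_lt ?_ hy
    exact mul_le_mul_of_nonneg_right (pow_le_pow_of_le_one (norm_nonneg _) hq.le hm)
      (norm_nonneg _)

/-- A solution of a second order `q`-difference equation with meromorphic coefficients which is
meromorphic near `0` extends to a meromorphic function on the plane. -/
theorem exists_meromorphic_extension (hq : ‖q‖ < 1) (hρ : 0 < ρ) (hP : Meromorphic P)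
    (hQ : Meromorphic Q) (hf : ∀ y, ‖y‖ < ρ → MeromorphicAt f y)
    (hrec : ∀ y, ‖y‖ < ρ → f y = P y * f (q * y) + Q y * f (q ^ 2 * y)) :
    ∃ M : ℂ → ℂ, Meromorphic M ∧ ∀ y, ‖y‖ < ρ → M y = f y := by
  have hex : ∀ y : ℂ, ∃ n : ℕ, ‖q‖ ^ n * ‖y‖ < ρ := fun y => by
    have : Tendsto (fun n : ℕ => ‖q‖ ^ n * ‖y‖) atTop (𝓝 (0 * ‖y‖)) :=
      (tendsto_pow_atTop_nhds_zero_of_lt_one (norm_nonneg _) hq).mul_const _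
    rw [zero_mul] at this
    exact (this.eventually_lt_const hρ).exists
  classical
  have key : ∀ (n : ℕ) (y : ℂ), ‖q‖ ^ n * ‖y‖ < ρ →
      -- Any admissible number of steps gives the same value, so the least one may be replaced near
      -- each point by a fixed n, for which meromorphy is known.
      qExtend q P Q f (Nat.find (hex y)) y = qExtend q P Q f n y := fun n y hy =>
    (qExtend_eq_of_le hq hrec (Nat.find_min' (hex y) hy) (Nat.find_spec (hex y))).symm
  refine ⟨fun y => qExtend q P Q f (Nat.find (hex y)) y, fun y => ?_, fun y hy => ?_⟩
  · obtain ⟨n, hn⟩ := hex y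
    refine (meromorphicAt_qExtend hq hP hQ hf n y hn).congr (Eventually.filter_mono
      nhdsWithin_le_nhds ?_)
    have : Continuous fun y : ℂ => ‖q‖ ^ n * ‖y‖ := by fun_prop
    filter_upwards [this.continuousAt.eventually_lt_const hn] with x hx
    exact (key n x hx).symm
  · exact key 0 y (by simpa using hy)

/-- The identity theorem for meromorphic functions. -/
theorem MeromorphicOn.eventuallyEq_of_isPreconnected {f g : ℂ → ℂ} {U : Set ℂ}
    (hf : MeromorphicOn f U) (hg : MeromorphicOn g U) (hU : IsPreconnected U) {x y : ℂ}
    (hx : x ∈ U) (hy : y ∈ U) (h : f =ᶠ[𝓝[≠] x] g) : f =ᶠ[𝓝[≠] y] g := by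
  have hfg := hf.sub hg
  -- Agreement on a punctured neighbourhood means that f - g has infinite order, a property that
  -- propagates over a preconnected set.
  have hx' : meromorphicOrderAt (f - g) x = ⊤ := by
    rw [meromorphicOrderAt_eq_top_iff]
    filter_upwards [h] with z hz
    simp [hz]
  by_contra hcon
  refine hfg.meromorphicOrderAt_ne_top_of_isPreconnected hU hy hx (fun htop => hcon ?_) hx'
  filter_upwards [meromorphicOrderAt_eq_top_iff.1 htop] with z hz
  exact sub_eq_zero.1 hz

end Recurrence

/-! ### The coefficients at the parameters of the two series -/

section Specialization

/-- The parameters `a₁, …, a₄` of the series in base `q = h²`. -/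
def lhsPars (h α β x : ℂ) : Fin 4 → ℂ :=
  ![h ^ 2 * x / (α * β), -(h * x), -(α * x / β), h * x]

/-- The parameters `a₁, …, a₄` of the series in base `q²`. -/
def rhsPars (q α β x : ℂ) : Fin 4 → ℂ :=
  ![q ^ 2 * x / (α * β), -(q * β * x / α), -(α * x / β), q * α * β * x]

/-- The coefficient of `Φ (q² y)` in the common `q`-difference equation. -/
def quadUp (q α β x y : ℂ) : ℂ :=
  x ^ 2 * (1 - q * y ^ 2) * (1 - α ^ 2 * q ^ 2 * y ^ 2) * (1 - q ^ 4 * y ^ 2 / α ^ 2) *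
    (1 - q ^ 3 * β ^ 2 * y ^ 2) * (1 - q ^ 3 * y ^ 2 / β ^ 2)

/-- The main factor of the coefficient of `Φ (q y)` in the common `q`-difference equation. -/
def quadMid (q α β x y : ℂ) : ℂ :=
  (1 - q ^ 2 * y ^ 2) * (-(1 + x ^ 2) + ((q + 1 / q) * (1 + x ^ 2) +
    (1 + q) * (x / q) * (α - q / α) * (1 / β - β)) * (q ^ 2 * y ^ 2)
      - (1 + x ^ 2) * (q ^ 2 * y ^ 2) ^ 2)

variable {h q α β x : ℂ}

theorem tau₄_lhsPars (hh : h ≠ 0) (hα : α ≠ 0) (hβ : β ≠ 0) (hx : x ≠ 0) :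
    tau₄ (lhsPars h α β x) = β ^ 2 / (h ^ 4 * x ^ 4) := by
  simp only [tau₄, lhsPars, Matrix.cons_val_zero, Matrix.cons_val_one, Matrix.cons_val]
  field_simp

theorem tau₃_lhsPars (hh : h ≠ 0) (hα : α ≠ 0) (hx : x ≠ 0) :
    tau₃ (lhsPars h α β x) = -(1 / (h ^ 2 * x ^ 2)) * (β * (α ^ 2 - h ^ 2) / (h ^ 2 * x * α)) := by
  simp only [tau₃, lhsPars, Matrix.cons_val_zero, Matrix.cons_val_one, Matrix.cons_val]
  field_simp
  ring

theorem tau₂_lhsPars (hh : h ≠ 0) (hα : α ≠ 0) (hx : x ≠ 0) :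
    tau₂ (lhsPars h α β x) = -(1 + β ^ 2) / (h ^ 2 * x ^ 2) := by
  simp only [tau₂, lhsPars, Matrix.cons_val_zero, Matrix.cons_val_one, Matrix.cons_val]
  field_simp
  ring

theorem tau₁_lhsPars (hh : h ≠ 0) (hα : α ≠ 0) (hx : x ≠ 0) :
    tau₁ (lhsPars h α β x) = β * (α ^ 2 - h ^ 2) / (h ^ 2 * x * α) := by
  simp only [tau₁, lhsPars, Matrix.cons_val_zero, Matrix.cons_val_one, Matrix.cons_val]
  field_simp
  ring

/-- The two extra factors arise when (-hβy; q)_∞ and (-hy/β; q)_∞ are moved into the unknown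
function; they complete the coefficient to one shared with the series in base q². -/
theorem lhs_coeffUp (hh : h ≠ 0) (hα : α ≠ 0) (hβ : β ≠ 0) (hx : x ≠ 0) (y : ℂ) :
    coeffUp (h ^ 2) (x ^ 2) (tau₁ (lhsPars h α β x)) (tau₂ (lhsPars h α β x))
      (tau₃ (lhsPars h α β x)) (tau₄ (lhsPars h α β x)) (-(h / β) * y) *
        ((1 - h ^ 2 * (-(h * β) * y)) * (1 - h ^ 2 * (-(h / β) * y))) =
      quadUp (h ^ 2) α β x y := by
  rw [tau₁_lhsPars hh hα hx, tau₂_lhsPars hh hα hx, tau₃_lhsPars hh hα hx,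
    tau₄_lhsPars hh hα hβ hx, coeffUp, pairPoly, quadUp]
  field_simp
  ring

theorem lhs_coeffMid (hh : h ≠ 0) (hα : α ≠ 0) (hβ : β ≠ 0) (hx : x ≠ 0) (y : ℂ) :
    coeffMid (h ^ 2) (x ^ 2) (tau₁ (lhsPars h α β x)) (tau₃ (lhsPars h α β x))
      (tau₄ (lhsPars h α β x)) (-(h / β) * y) = quadMid (h ^ 2) α β x y := by
  rw [tau₁_lhsPars hh hα hx, tau₃_lhsPars hh hα hx, tau₄_lhsPars hh hα hβ hx, coeffMid,
    quadMid]
  field_simp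
  ring

theorem lhs_coeffDown (hh : h ≠ 0) (hα : α ≠ 0) (hβ : β ≠ 0) (hx : x ≠ 0) (y : ℂ) :
    coeffDown (h ^ 2) (x ^ 2) (tau₄ (lhsPars h α β x)) (-(h / β) * y) =
      (1 - -(h / β) * y) * (1 - -(h * β) * y) * (1 - (h ^ 2) ^ 3 * y ^ 2) := by
  rw [tau₄_lhsPars hh hα hβ hx, coeffDown]
  field_simp

theorem tau₄_rhsPars (hq : q ≠ 0) (hα : α ≠ 0) (hβ : β ≠ 0) (hx : x ≠ 0) :
    tau₄ (rhsPars q α β x) = 1 / (q ^ 4 * x ^ 4) := by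
  simp only [tau₄, rhsPars, Matrix.cons_val_zero, Matrix.cons_val_one, Matrix.cons_val]
  field_simp

theorem tau₁_rhsPars (hq : q ≠ 0) (hα : α ≠ 0) (hβ : β ≠ 0) (hx : x ≠ 0) :
    tau₁ (rhsPars q α β x) =
      (α ^ 2 * β ^ 2 - q * α ^ 2 - q ^ 2 * β ^ 2 + q) / (q ^ 2 * x * α * β) := by
  simp only [tau₁, rhsPars, Matrix.cons_val_zero, Matrix.cons_val_one, Matrix.cons_val]
  field_simp
  ring

theorem tau₂_rhsPars (hq : q ≠ 0) (hα : α ≠ 0) (hβ : β ≠ 0) (hx : x ≠ 0) :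
    tau₂ (rhsPars q α β x) =
      (-α ^ 2 / q ^ 3 - β ^ 2 / q ^ 2 + 1 / q ^ 3 + 1 / q - 1 / (q ^ 2 * β ^ 2) - 1 / (q * α ^ 2)) /
        x ^ 2 := by
  simp only [tau₂, rhsPars, Matrix.cons_val_zero, Matrix.cons_val_one, Matrix.cons_val]
  field_simp
  ring

theorem tau₃_rhsPars (hq : q ≠ 0) (hα : α ≠ 0) (hβ : β ≠ 0) (hx : x ≠ 0) :
    tau₃ (rhsPars q α β x) =
      (q * α ^ 2 * β ^ 2 - α ^ 2 - q * β ^ 2 + q ^ 2) / (q ^ 4 * x ^ 3 * α * β) := by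
  simp only [tau₃, rhsPars, Matrix.cons_val_zero, Matrix.cons_val_one, Matrix.cons_val]
  field_simp
  ring

/-- The surplus factors 1 + q^j y², here and in the next two coefficients, are those absorbed by
(-qy²; q²)_∞ and (-q²y²; q²)_∞. -/
theorem rhs_coeffUp (hq : q ≠ 0) (hα : α ≠ 0) (hβ : β ≠ 0) (hx : x ≠ 0) (y : ℂ) :
    coeffUp (q ^ 2) (x ^ 2) (tau₁ (rhsPars q α β x)) (tau₂ (rhsPars q α β x))
      (tau₃ (rhsPars q α β x)) (tau₄ (rhsPars q α β x)) (-q * y ^ 2) =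
      quadUp q α β x y * ((1 + q ^ 4 * y ^ 2) * (1 + q ^ 2 * y ^ 2) * (1 + q * y ^ 2)) := by
  rw [tau₁_rhsPars hq hα hβ hx, tau₂_rhsPars hq hα hβ hx, tau₃_rhsPars hq hα hβ hx,
    tau₄_rhsPars hq hα hβ hx, coeffUp, pairPoly, quadUp]
  field_simp
  ring

theorem rhs_coeffMid (hq : q ≠ 0) (hα : α ≠ 0) (hβ : β ≠ 0) (hx : x ≠ 0) (y : ℂ) :
    coeffMid (q ^ 2) (x ^ 2) (tau₁ (rhsPars q α β x)) (tau₃ (rhsPars q α β x))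
      (tau₄ (rhsPars q α β x)) (-q * y ^ 2) =
      quadMid q α β x y * ((1 + q ^ 2 * y ^ 2) * (1 + q * y ^ 2) * (1 + q ^ 3 * y ^ 2)) := by
  rw [tau₁_rhsPars hq hα hβ hx, tau₃_rhsPars hq hα hβ hx, tau₄_rhsPars hq hα hβ hx, coeffMid,
    quadMid]
  field_simp
  ring

theorem rhs_coeffDown (hq : q ≠ 0) (hα : α ≠ 0) (hβ : β ≠ 0) (hx : x ≠ 0) (y : ℂ) :
    coeffDown (q ^ 2) (x ^ 2) (tau₄ (rhsPars q α β x)) (-q * y ^ 2) =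
      (1 + q * y ^ 2) ^ 2 * ((1 - q ^ 3 * y ^ 2) * (1 + q ^ 3 * y ^ 2)) := by
  rw [tau₄_rhsPars hq hα hβ hx, coeffDown]
  field_simp
  ring

end Specialization

/-! ### Both sides satisfy the same q-difference equation -/

section CommonEquation

variable {h q d α β x : ℂ} {p : Fin 4 → ℂ}

theorem analyticAt_regSum (hq : ‖q‖ < 1) (hd : ∀ n : ℕ, q * d * q ^ n ≠ 1) {Z : ℂ}
    (hZ : ‖vwpScale q d p * Z‖ < 1) : AnalyticAt ℂ (regSum q d p) Z := by
  rw [Complex.analyticAt_iff_eventually_differentiableAt]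
  have : Continuous fun Y : ℂ => ‖vwpScale q d p * Y‖ := by fun_prop
  filter_upwards [this.continuousAt.eventually_lt_const hZ] with Y hY
  exact differentiableAt_regSum hq hd hY

theorem regSum_eq (hq : ‖q‖ < 1) {Z : ℂ} (h1 : ‖Z‖ < 1) (h2 : ‖d * Z‖ < 1) :
    regSum q d p Z = normSum q d p Z * (qFactInf q (d * Z) * qFactInf q Z) := by
  rw [normSum, div_mul_cancel₀]
  exact mul_ne_zero (qFactInf_ne_zero_of_norm_lt hq h2) (qFactInf_ne_zero_of_norm_lt hq h1)

theorem qFactInf_eq_mul_mul (hq : ‖q‖ < 1) (c y : ℂ) :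
    qFactInf q (c * y) = (1 - c * y) * qFactInf q (c * (q * y)) ∧
      qFactInf q (c * (q * y)) = (1 - q * (c * y)) * qFactInf q (c * (q ^ 2 * y)) := by
  constructor
  · rw [qFactInf_eq_mul hq]
    ring_nf
  · rw [qFactInf_eq_mul hq]
    ring_nf

theorem norm_sq_mul_lt_one (hq : ‖q‖ < 1) {y : ℂ} (h : ‖y‖ < 1) : ‖q ^ 2 * y‖ < 1 := by
  rw [pow_two, mul_assoc]
  exact norm_mul_lt_one hq (norm_mul_lt_one hq h)

/-- The denominator of `lhsQuad`. -/
def lhsQuadDen (h β x z : ℂ) : ℂ :=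
  qFactInf (h ^ 2) (x ^ 2 * (-(h / β) * z)) *
    (qFactInf (h ^ 2) (h ^ 2 * x / β * z) * qFactInf (h ^ 2) (-(h ^ 2 * x / β) * z))

/-- The series in base `q = h²` with its prefactor. -/
def lhsQuad (h α β x z : ℂ) : ℂ :=
  qFactInf (h ^ 2) (-(h * β) * z) *
    regSum (h ^ 2) (x ^ 2) (lhsPars h α β x) (-(h / β) * z) / lhsQuadDen h β x z

/-- The denominator of `rhsQuad`. -/
def rhsQuadDen (q β x z : ℂ) : ℂ :=
  qFactInf (q ^ 2) (x ^ 2 * (-q * z ^ 2)) *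
    (qFactInf (q ^ 2) (-q ^ 2 * z ^ 2) * qFactInf (q ^ 2) (q ^ 2 * x ^ 2 / β ^ 2 * z ^ 2))

/-- The series in base `q²` with its prefactor. -/
def rhsQuad (q α β x z : ℂ) : ℂ :=
  regSum (q ^ 2) (x ^ 2) (rhsPars q α β x) (-q * z ^ 2) / rhsQuadDen q β x z

theorem eventually_norm_mul_lt_one (c : ℂ) : ∀ᶠ y in 𝓝 (0 : ℂ), ‖c * y‖ < 1 := by
  have : Continuous fun y : ℂ => ‖c * y‖ := by fun_prop
  exact this.continuousAt.eventually_lt_const (by simp)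

theorem eventually_norm_mul_sq_lt_one (c : ℂ) : ∀ᶠ y in 𝓝 (0 : ℂ), ‖c * y ^ 2‖ < 1 := by
  have : Continuous fun y : ℂ => ‖c * y ^ 2‖ := by fun_prop
  exact this.continuousAt.eventually_lt_const (by simp)

theorem lhsPars_ne_zero (hh : h ≠ 0) (hα : α ≠ 0) (hβ : β ≠ 0) (hx : x ≠ 0) (i : Fin 4) :
    lhsPars h α β x i ≠ 0 := by
  fin_cases i <;> simp [lhsPars, hh, hα, hβ, hx]

theorem rhsPars_ne_zero (hq : q ≠ 0) (hα : α ≠ 0) (hβ : β ≠ 0) (hx : x ≠ 0) (i : Fin 4) :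
    rhsPars q α β x i ≠ 0 := by
  fin_cases i <;> simp [rhsPars, hq, hα, hβ, hx]

/-- The contiguous relation rewritten for the series with its prefactor. The products at ±h²xy/β in
the denominator combine in pairs, since (1 - t)(1 + t) = 1 - t²; hence the equation has the shape of
the one in base q². -/
theorem lhsQuad_equation (hh : h ≠ 0) (hq : ‖h ^ 2‖ < 1) (hα : α ≠ 0) (hβ : β ≠ 0) (hx : x ≠ 0)
    (hd : ∀ n : ℕ, h ^ 2 * x ^ 2 * (h ^ 2) ^ n ≠ 1) :
    ∀ᶠ y in 𝓝 0, quadUp (h ^ 2) α β x y * lhsQuad h α β x ((h ^ 2) ^ 2 * y)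
      + quadMid (h ^ 2) α β x y * (1 - (h ^ 2 * (h ^ 2 * x / β * y)) ^ 2) *
        lhsQuad h α β x (h ^ 2 * y)
      + (1 - (h ^ 2 * x / β * y) ^ 2) * (1 - (h ^ 2 * (h ^ 2 * x / β * y)) ^ 2) *
        (1 - (h ^ 2) ^ 3 * y ^ 2) * lhsQuad h α β x y = 0 := by
  filter_upwards [eventually_norm_mul_lt_one (-(h / β)),
    eventually_norm_mul_lt_one (x ^ 2 * -(h / β)), eventually_norm_mul_lt_one (h ^ 2 * x / β),
    eventually_norm_mul_lt_one (vwpScale (h ^ 2) (x ^ 2) (lhsPars h α β x) * -(h / β)),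
    eventually_norm_mul_lt_one (-(h ^ 2 * x / β))] with y h1 h2 h3 h4 h5
  rw [mul_assoc] at h2 h4
  have hrec := normSum_contiguous hq hd (lhsPars_ne_zero hh hα hβ hx) h1 h2 h4
  have eU := lhs_coeffUp hh hα hβ hx y
  have eM := lhs_coeffMid hh hα hβ hx y
  have eD := lhs_coeffDown hh hα hβ hx y
  rw [eM, eD] at hrec
  rw [← eU]
  -- The product (x²Z; q)_∞ in the denominator of `lhsQuad` cancels the one in the normalization of
  -- `normSum`.
  have main : ∀ z, ‖-(h / β) * z‖ < 1 → ‖x ^ 2 * (-(h / β) * z)‖ < 1 →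
      lhsQuad h α β x z = qFactInf (h ^ 2) (-(h * β) * z) * qFactInf (h ^ 2) (-(h / β) * z) *
        normSum (h ^ 2) (x ^ 2) (lhsPars h α β x) (-(h / β) * z) /
        (qFactInf (h ^ 2) (h ^ 2 * x / β * z) * qFactInf (h ^ 2) (-(h ^ 2 * x / β) * z)) := by
    intro z g1 g2
    have n1 := qFactInf_ne_zero_of_norm_lt hq g2
    rw [lhsQuad, lhsQuadDen, regSum_eq hq g1 g2]
    generalize qFactInf (h ^ 2) (x ^ 2 * (-(h / β) * z)) = X at *
    rw [show ∀ a b c e f : ℂ, a * (b * (X * c)) / (X * (e * f)) = X * (a * c * b) / (X * (e * f))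
      from fun a b c e f => by ring, mul_div_mul_left _ _ n1]
  have g1 : ‖-(h / β) * (h ^ 2 * y)‖ < 1 := by
    rw [mul_left_comm]
    exact norm_mul_lt_one hq h1
  have g2 : ‖x ^ 2 * (-(h / β) * (h ^ 2 * y))‖ < 1 := by
    rw [mul_left_comm (-(h / β)), mul_left_comm]
    exact norm_mul_lt_one hq h2
  have k1 : ‖-(h / β) * ((h ^ 2) ^ 2 * y)‖ < 1 := by
    rw [mul_left_comm]
    exact norm_sq_mul_lt_one hq h1
  have k2 : ‖x ^ 2 * (-(h / β) * ((h ^ 2) ^ 2 * y))‖ < 1 := by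
    rw [mul_left_comm (-(h / β)), mul_left_comm]
    exact norm_sq_mul_lt_one hq h2
  rw [main y h1 h2, main _ g1 g2, main _ k1 k2]
  obtain ⟨w0, w1⟩ := qFactInf_eq_mul_mul hq (-(h * β)) y
  obtain ⟨z0, z1⟩ := qFactInf_eq_mul_mul hq (-(h / β)) y
  obtain ⟨p0, p1⟩ := qFactInf_eq_mul_mul hq (h ^ 2 * x / β) y
  obtain ⟨m0, m1⟩ := qFactInf_eq_mul_mul hq (-(h ^ 2 * x / β)) y
  have np := qFactInf_ne_zero_of_norm_lt hq h3
  have nm := qFactInf_ne_zero_of_norm_lt hq h5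
  rw [p0, p1] at np
  rw [m0, m1] at nm
  rw [w0, w1, z0, z1, p0, p1, m0, m1]
  rw [show -(h / β) * ((h ^ 2) ^ 2 * y) = (h ^ 2) ^ 2 * (-(h / β) * y) by ring,
    show -(h / β) * (h ^ 2 * y) = h ^ 2 * (-(h / β) * y) by ring]
  have a1 := left_ne_zero_of_mul np
  have a2 := left_ne_zero_of_mul (right_ne_zero_of_mul np)
  have a3 := right_ne_zero_of_mul (right_ne_zero_of_mul np)
  have b1 := left_ne_zero_of_mul nm
  have b2 := left_ne_zero_of_mul (right_ne_zero_of_mul nm)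
  have b3 := right_ne_zero_of_mul (right_ne_zero_of_mul nm)
  rw [neg_mul (h ^ 2 * x / β) y] at b1 b2 ⊢
  generalize coeffUp (h ^ 2) (x ^ 2) (tau₁ (lhsPars h α β x)) (tau₂ (lhsPars h α β x))
      (tau₃ (lhsPars h α β x)) (tau₄ (lhsPars h α β x)) (-(h / β) * y) = cU at *
  generalize quadMid (h ^ 2) α β x y = cM at *
  generalize normSum (h ^ 2) (x ^ 2) (lhsPars h α β x) ((h ^ 2) ^ 2 * (-(h / β) * y)) = F2 at *
  generalize normSum (h ^ 2) (x ^ 2) (lhsPars h α β x) (h ^ 2 * (-(h / β) * y)) = F1 at *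
  generalize normSum (h ^ 2) (x ^ 2) (lhsPars h α β x) (-(h / β) * y) = F0 at *
  generalize qFactInf (h ^ 2) (-(h ^ 2 * x / β) * ((h ^ 2) ^ 2 * y)) = B at *
  generalize qFactInf (h ^ 2) (h ^ 2 * x / β * ((h ^ 2) ^ 2 * y)) = A at *
  generalize qFactInf (h ^ 2) (-(h * β) * ((h ^ 2) ^ 2 * y)) = W at *
  generalize qFactInf (h ^ 2) ((h ^ 2) ^ 2 * (-(h / β) * y)) = Z at *
  generalize h ^ 2 * x / β * y = t at *
  generalize -(h * β) * y = w at *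
  generalize -(h / β) * y = v at *
  generalize h ^ 2 = k at *
  have d1 : 1 - t ^ 2 ≠ 0 := by
    rw [show 1 - t ^ 2 = (1 - t) * (1 - -t) by ring]
    exact mul_ne_zero a1 b1
  have d2 : 1 - (k * t) ^ 2 ≠ 0 := by
    rw [show 1 - (k * t) ^ 2 = (1 - k * t) * (1 - k * -t) by ring]
    exact mul_ne_zero a2 b2
  rw [show (1 - t) * ((1 - k * t) * A) * ((1 - -t) * ((1 - k * -t) * B)) =
      (1 - t ^ 2) * (1 - (k * t) ^ 2) * (A * B) by ring,
    show (1 - k * t) * A * ((1 - k * -t) * B) = (1 - (k * t) ^ 2) * (A * B) by ring]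
  generalize 1 - t ^ 2 = D1 at *
  generalize 1 - (k * t) ^ 2 = D2 at *
  field_simp
  linear_combination (1 - k * w) * (1 - k * v) * W * Z * hrec

/-- Replacing y by qy multiplies -qy² by q², the base of this series, so the contiguous relation
again involves y, qy and q²y. -/
theorem rhsQuad_equation (hq0 : q ≠ 0) (hq : ‖q ^ 2‖ < 1) (hα : α ≠ 0) (hβ : β ≠ 0) (hx : x ≠ 0)
    (hd : ∀ n : ℕ, q ^ 2 * x ^ 2 * (q ^ 2) ^ n ≠ 1) :
    ∀ᶠ y in 𝓝 0, quadUp q α β x y * rhsQuad q α β x (q ^ 2 * y)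
      + quadMid q α β x y * (1 - (q * (q * x / β * y)) ^ 2) * rhsQuad q α β x (q * y)
      + (1 - (q * x / β * y) ^ 2) * (1 - (q * (q * x / β * y)) ^ 2) *
        (1 - q ^ 3 * y ^ 2) * rhsQuad q α β x y = 0 := by
  filter_upwards [eventually_norm_mul_sq_lt_one (-q),
    eventually_norm_mul_sq_lt_one (x ^ 2 * -q), eventually_norm_mul_sq_lt_one (-q ^ 2),
    eventually_norm_mul_sq_lt_one (vwpScale (q ^ 2) (x ^ 2) (rhsPars q α β x) * -q),
    eventually_norm_mul_sq_lt_one (q ^ 2 * x ^ 2 / β ^ 2),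
    eventually_norm_mul_sq_lt_one (-q ^ 3)] with y h1 h2 h3 h4 h5 h6
  rw [mul_assoc] at h2 h4
  have hrec := normSum_contiguous hq hd (rhsPars_ne_zero hq0 hα hβ hx) h1 h2 h4
  have eU := rhs_coeffUp hq0 hα hβ hx y
  have eM := rhs_coeffMid hq0 hα hβ hx y
  have eD := rhs_coeffDown hq0 hα hβ hx y
  rw [eU, eM, eD] at hrec
  have main : ∀ z, ‖-q * z ^ 2‖ < 1 → ‖x ^ 2 * (-q * z ^ 2)‖ < 1 →
      rhsQuad q α β x z = qFactInf (q ^ 2) (-q * z ^ 2) *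
        normSum (q ^ 2) (x ^ 2) (rhsPars q α β x) (-q * z ^ 2) /
        (qFactInf (q ^ 2) (-q ^ 2 * z ^ 2) *
          qFactInf (q ^ 2) (q ^ 2 * x ^ 2 / β ^ 2 * z ^ 2)) := by
    intro z g1 g2
    have n1 := qFactInf_ne_zero_of_norm_lt hq g2
    rw [rhsQuad, rhsQuadDen, regSum_eq hq g1 g2]
    generalize qFactInf (q ^ 2) (x ^ 2 * (-q * z ^ 2)) = X at *
    rw [show ∀ b c e f : ℂ, b * (X * c) / (X * (e * f)) = X * (c * b) / (X * (e * f))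
      from fun b c e f => by ring, mul_div_mul_left _ _ n1]
  have s1 : (q * y) ^ 2 = q ^ 2 * y ^ 2 := mul_pow _ _ _
  have s2 : (q ^ 2 * y) ^ 2 = (q ^ 2) ^ 2 * y ^ 2 := mul_pow _ _ _
  have g1 : ‖-q * (q * y) ^ 2‖ < 1 := by
    rw [s1, mul_left_comm]
    exact norm_mul_lt_one hq h1
  have g2 : ‖x ^ 2 * (-q * (q * y) ^ 2)‖ < 1 := by
    rw [s1, mul_left_comm (-q), mul_left_comm]
    exact norm_mul_lt_one hq h2
  have k1 : ‖-q * (q ^ 2 * y) ^ 2‖ < 1 := by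
    rw [s2, mul_left_comm]
    exact norm_sq_mul_lt_one hq h1
  have k2 : ‖x ^ 2 * (-q * (q ^ 2 * y) ^ 2)‖ < 1 := by
    rw [s2, mul_left_comm (-q), mul_left_comm]
    exact norm_sq_mul_lt_one hq h2
  rw [main y h1 h2, main _ g1 g2, main _ k1 k2, s1, s2]
  obtain ⟨z0, z1⟩ := qFactInf_eq_mul_mul hq (-q) (y ^ 2)
  obtain ⟨p0, p1⟩ := qFactInf_eq_mul_mul hq (-q ^ 2) (y ^ 2)
  obtain ⟨m0, m1⟩ := qFactInf_eq_mul_mul hq (q ^ 2 * x ^ 2 / β ^ 2) (y ^ 2)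
  have np := qFactInf_ne_zero_of_norm_lt hq h3
  have nm := qFactInf_ne_zero_of_norm_lt hq h5
  have c1 : 1 + q * y ^ 2 ≠ 0 := by
    have := sub_ne_zero.2 (mul_pow_ne_one hq h1 0).symm
    simpa using this
  have c3 : 1 + q ^ 3 * y ^ 2 ≠ 0 := by
    have := sub_ne_zero.2 (mul_pow_ne_one hq h6 0).symm
    simpa using this
  rw [p0, p1] at np
  rw [m0, m1] at nm
  rw [z0, z1, p0, p1, m0, m1]
  rw [show -q * ((q ^ 2) ^ 2 * y ^ 2) = (q ^ 2) ^ 2 * (-q * y ^ 2) by ring,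
    show -q * (q ^ 2 * y ^ 2) = q ^ 2 * (-q * y ^ 2) by ring]
  have a1 := left_ne_zero_of_mul np
  have a2 := left_ne_zero_of_mul (right_ne_zero_of_mul np)
  have a3 := right_ne_zero_of_mul (right_ne_zero_of_mul np)
  have b1 := left_ne_zero_of_mul nm
  have b2 := left_ne_zero_of_mul (right_ne_zero_of_mul nm)
  have b3 := right_ne_zero_of_mul (right_ne_zero_of_mul nm)
  generalize quadUp q α β x y = cU at *
  generalize quadMid q α β x y = cM at *
  generalize normSum (q ^ 2) (x ^ 2) (rhsPars q α β x) ((q ^ 2) ^ 2 * (-q * y ^ 2)) = F2 at *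
  generalize normSum (q ^ 2) (x ^ 2) (rhsPars q α β x) (q ^ 2 * (-q * y ^ 2)) = F1 at *
  generalize normSum (q ^ 2) (x ^ 2) (rhsPars q α β x) (-q * y ^ 2) = F0 at *
  generalize qFactInf (q ^ 2) (-q ^ 2 * ((q ^ 2) ^ 2 * y ^ 2)) = A at *
  generalize qFactInf (q ^ 2) (q ^ 2 * x ^ 2 / β ^ 2 * ((q ^ 2) ^ 2 * y ^ 2)) = B at *
  generalize qFactInf (q ^ 2) ((q ^ 2) ^ 2 * (-q * y ^ 2)) = Z at *
  have d1 : 1 - q ^ 2 * x ^ 2 / β ^ 2 * y ^ 2 = 1 - (q * x / β * y) ^ 2 := by ring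
  have d2 : 1 - q ^ 2 * (q ^ 2 * x ^ 2 / β ^ 2 * y ^ 2) = 1 - (q * (q * x / β * y)) ^ 2 := by ring
  have e1 : 1 - -q ^ 2 * y ^ 2 = 1 + q ^ 2 * y ^ 2 := by ring
  have e2 : 1 - q ^ 2 * (-q ^ 2 * y ^ 2) = 1 + q ^ 4 * y ^ 2 := by ring
  have e3 : 1 - -q * y ^ 2 = 1 + q * y ^ 2 := by ring
  have e4 : 1 - q ^ 2 * (-q * y ^ 2) = 1 + q ^ 3 * y ^ 2 := by ring
  rw [d1] at b1 ⊢
  rw [d2] at b2 ⊢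
  rw [e1] at a1 ⊢
  rw [e2] at a2 ⊢
  rw [e3, e4]
  generalize 1 - (q * x / β * y) ^ 2 = D1 at *
  generalize 1 - (q * (q * x / β * y)) ^ 2 = D2 at *
  generalize 1 + q ^ 2 * y ^ 2 = E2 at *
  generalize 1 + q ^ 4 * y ^ 2 = E4 at *
  generalize 1 + q * y ^ 2 = E1 at *
  generalize 1 + q ^ 3 * y ^ 2 = E3 at *
  generalize 1 - q ^ 3 * y ^ 2 = G at *
  -- The left side is the contiguous relation times a quotient of products that are nonzero near 0
  -- in the denominator.
  calc _ = (cU * (E4 * E2 * E1) * F2 + cM * (E2 * E1 * E3) * F1 + E1 ^ 2 * (G * E3) * F0) *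
        (Z / (E4 * A * B * E2 * E1)) := by field_simp
    _ = 0 := by rw [hrec, zero_mul]

end CommonEquation

/-! ### Equality of the two sides and their common continuation -/

section Comparison

variable {h α β x : ℂ}

theorem lhs_scale (hh : h ≠ 0) (hα : α ≠ 0) (hβ : β ≠ 0) (hx : x ≠ 0) :
    vwpScale (h ^ 2) (x ^ 2) (lhsPars h α β x) * -(h / β) = -(h * β) := by
  rw [vwpScale_eq, tau₄_lhsPars hh hα hβ hx]
  field_simp

theorem rhs_scale {q : ℂ} (hq : q ≠ 0) (hα : α ≠ 0) (hβ : β ≠ 0) (hx : x ≠ 0) :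
    vwpScale (q ^ 2) (x ^ 2) (rhsPars q α β x) = 1 := by
  rw [vwpScale_eq, tau₄_rhsPars hq hα hβ hx]
  field_simp

theorem differentiable_lhsQuadDen (hq : ‖h ^ 2‖ < 1) (β x : ℂ) :
    Differentiable ℂ (lhsQuadDen h β x) := by
  have := differentiable_qFactInf hq
  unfold lhsQuadDen
  fun_prop

theorem differentiable_rhsQuadDen {q : ℂ} (hq : ‖q ^ 2‖ < 1) (β x : ℂ) :
    Differentiable ℂ (rhsQuadDen q β x) := by
  have := differentiable_qFactInf hq
  unfold rhsQuadDen
  fun_prop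

theorem lhsQuadDen_zero (h β x : ℂ) : lhsQuadDen h β x 0 = 1 := by
  simp [lhsQuadDen, qFactInf_zero]

theorem rhsQuadDen_zero (q β x : ℂ) : rhsQuadDen q β x 0 = 1 := by
  simp [rhsQuadDen, qFactInf_zero]

theorem analyticAt_lhsQuad_num (hh : h ≠ 0) (hq : ‖h ^ 2‖ < 1) (hα : α ≠ 0) (hβ : β ≠ 0)
    (hx : x ≠ 0) (hd : ∀ n : ℕ, h ^ 2 * x ^ 2 * (h ^ 2) ^ n ≠ 1) {z : ℂ}
    (hz : ‖-(h * β) * z‖ < 1) :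
    AnalyticAt ℂ (fun z => qFactInf (h ^ 2) (-(h * β) * z) *
      regSum (h ^ 2) (x ^ 2) (lhsPars h α β x) (-(h / β) * z)) z := by
  have h1 : AnalyticAt ℂ (fun z => qFactInf (h ^ 2) (-(h * β) * z)) z :=
    ((differentiable_qFactInf hq).analyticAt _).comp (by fun_prop)
  have h2 : AnalyticAt ℂ (regSum (h ^ 2) (x ^ 2) (lhsPars h α β x)) (-(h / β) * z) :=
    analyticAt_regSum hq hd (by rwa [← mul_assoc, lhs_scale hh hα hβ hx])
  exact h1.mul (h2.comp (g := regSum (h ^ 2) (x ^ 2) (lhsPars h α β x))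
    (f := fun z => -(h / β) * z) (by fun_prop))

theorem analyticAt_rhsQuad_num {q : ℂ} (hq0 : q ≠ 0) (hq : ‖q ^ 2‖ < 1) (hα : α ≠ 0) (hβ : β ≠ 0)
    (hx : x ≠ 0) (hd : ∀ n : ℕ, q ^ 2 * x ^ 2 * (q ^ 2) ^ n ≠ 1) {z : ℂ}
    (hz : ‖-q * z ^ 2‖ < 1) :
    AnalyticAt ℂ (fun z => regSum (q ^ 2) (x ^ 2) (rhsPars q α β x) (-q * z ^ 2)) z := by
  have h2 : AnalyticAt ℂ (regSum (q ^ 2) (x ^ 2) (rhsPars q α β x)) (-q * z ^ 2) :=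
    analyticAt_regSum hq hd (by rwa [rhs_scale hq0 hα hβ hx, one_mul])
  exact h2.comp (g := regSum (q ^ 2) (x ^ 2) (rhsPars q α β x))
    (f := fun z => -q * z ^ 2) (by fun_prop)

/-- The nonresonance condition in base q² is the one in base q at odd indices. -/
theorem mul_pow_ne_one_of_sq {q : ℂ} (hd : ∀ n : ℕ, q * x ^ 2 * q ^ n ≠ 1) (n : ℕ) :
    q ^ 2 * x ^ 2 * (q ^ 2) ^ n ≠ 1 := by
  have := hd (2 * n + 1)
  rwa [show q * x ^ 2 * q ^ (2 * n + 1) = q ^ 2 * x ^ 2 * (q ^ 2) ^ n by ring] at this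

theorem norm_sq_lt_one {q : ℂ} (hq : ‖q‖ < 1) : ‖q ^ 2‖ < 1 := by
  rw [norm_pow]
  exact pow_lt_one₀ (norm_nonneg _) hq two_ne_zero

theorem lhsQuad_eventuallyEq (hh : h ≠ 0) (hq : ‖h ^ 2‖ < 1) (hα : α ≠ 0) (hβ : β ≠ 0)
    (hx : x ≠ 0) (hd : ∀ n : ℕ, h ^ 2 * x ^ 2 * (h ^ 2) ^ n ≠ 1) :
    lhsQuad h α β x =ᶠ[𝓝 0] rhsQuad (h ^ 2) α β x := by
  have hh2 : h ^ 2 ≠ 0 := pow_ne_zero 2 hh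
  have aL : AnalyticAt ℂ (lhsQuad h α β x) 0 :=
    (analyticAt_lhsQuad_num hh hq hα hβ hx hd (by simp)).div
      ((differentiable_lhsQuadDen hq β x).analyticAt 0) (by simp [lhsQuadDen_zero])
  have aR : AnalyticAt ℂ (rhsQuad (h ^ 2) α β x) 0 :=
    (analyticAt_rhsQuad_num hh2 (norm_sq_lt_one hq) hα hβ hx (mul_pow_ne_one_of_sq hd)
      (by simp)).div ((differentiable_rhsQuadDen (norm_sq_lt_one hq) β x).analyticAt 0)
      (by simp [rhsQuadDen_zero])
  have vL : lhsQuad h α β x 0 = 1 := by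
    simp [lhsQuad, lhsQuadDen_zero, regSum_zero, qFactInf_zero]
  have vR : rhsQuad (h ^ 2) α β x 0 = 1 := by
    simp [rhsQuad, rhsQuadDen_zero, regSum_zero]
  have key := eventually_eq_zero_of_qDifference (q := h ^ 2) (aL.sub aR)
    (by simp [vL, vR])
    (A := quadUp (h ^ 2) α β x)
    (B := fun y => quadMid (h ^ 2) α β x y * (1 - (h ^ 2 * (h ^ 2 * x / β * y)) ^ 2))
    (C := fun y => (1 - (h ^ 2 * x / β * y) ^ 2) * (1 - (h ^ 2 * (h ^ 2 * x / β * y)) ^ 2) *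
        (1 - (h ^ 2) ^ 3 * y ^ 2))
    (by unfold quadUp; fun_prop) (by unfold quadMid; fun_prop) (by fun_prop)
    (by
      filter_upwards [lhsQuad_equation hh hq hα hβ hx hd,
        rhsQuad_equation hh2 (norm_sq_lt_one hq) hα hβ hx (mul_pow_ne_one_of_sq hd)] with y e1 e2
      simp only [Pi.sub_apply]
      linear_combination e1 - e2)
    (by
      -- With u = q^n the characteristic polynomial x²u² - (1 + x²)u + 1 factors as (1 - u)(1 -
      -- x²u); neither factor vanishes for n ≥ 1.
      intro n hn
      obtain ⟨m, rfl⟩ := Nat.exists_eq_succ_of_ne_zero hn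
      have f1 : 1 - (h ^ 2) ^ (m + 1) ≠ 0 := by
        have := self_mul_pow_ne_one hq m
        rw [← pow_succ'] at this
        exact sub_ne_zero.2 this.symm
      have f2 : 1 - x ^ 2 * (h ^ 2) ^ (m + 1) ≠ 0 := by
        have := hd m
        rw [show h ^ 2 * x ^ 2 * (h ^ 2) ^ m = x ^ 2 * (h ^ 2) ^ (m + 1) by ring] at this
        exact sub_ne_zero.2 this.symm
      have := mul_ne_zero f1 f2
      simp only [quadUp, quadMid, Nat.succ_eq_add_one]
      intro h0
      apply this
      linear_combination h0)
  filter_upwards [key] with y hy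
  exact sub_eq_zero.1 hy

/-- The two regularized series with their prefactors agree wherever both converge. -/
theorem lhsQuad_eq_rhsQuad (hh : h ≠ 0) (hq : ‖h ^ 2‖ < 1) (hα : α ≠ 0) (hβ : β ≠ 0)
    (hx : x ≠ 0) (hd : ∀ n : ℕ, h ^ 2 * x ^ 2 * (h ^ 2) ^ n ≠ 1) {z : ℂ}
    (hz1 : ‖-(h * β) * z‖ < 1) (hz2 : ‖-h ^ 2 * z ^ 2‖ < 1) (hL : lhsQuadDen h β x z ≠ 0)
    (hR : rhsQuadDen (h ^ 2) β x z ≠ 0) : lhsQuad h α β x z = rhsQuad (h ^ 2) α β x z := by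
  have hh2 : h ^ 2 ≠ 0 := pow_ne_zero 2 hh
  -- The denominators may vanish elsewhere in the disc of radius ‖z‖. Cross-multiplied, both sides
  -- are analytic on that whole disc and the identity theorem applies.
  rw [lhsQuad, rhsQuad, div_eq_div_iff hL hR]
  have dL := differentiable_lhsQuadDen hq β x
  have dR := differentiable_rhsQuadDen (norm_sq_lt_one hq) β x
  have a1 : AnalyticOnNhd ℂ (fun z => qFactInf (h ^ 2) (-(h * β) * z) *
      regSum (h ^ 2) (x ^ 2) (lhsPars h α β x) (-(h / β) * z) * rhsQuadDen (h ^ 2) β x z)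
      (Metric.closedBall 0 ‖z‖) := fun y hy => by
    refine (analyticAt_lhsQuad_num hh hq hα hβ hx hd (lt_of_le_of_lt ?_ hz1)).mul (dR.analyticAt y)
    rw [norm_mul, norm_mul]
    gcongr
    simpa using hy
  have a2 : AnalyticOnNhd ℂ (fun z => regSum ((h ^ 2) ^ 2) (x ^ 2) (rhsPars (h ^ 2) α β x)
      (-h ^ 2 * z ^ 2) * lhsQuadDen h β x z) (Metric.closedBall 0 ‖z‖) := fun y hy => by
    refine (analyticAt_rhsQuad_num hh2 (norm_sq_lt_one hq) hα hβ hx (mul_pow_ne_one_of_sq hd)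
      (lt_of_le_of_lt ?_ hz2)).mul (dL.analyticAt y)
    rw [norm_mul, norm_mul, norm_pow, norm_pow]
    gcongr
    simpa using hy
  refine a1.eqOn_of_preconnected_of_eventuallyEq a2 (convex_closedBall _ _).isPreconnected
    (Metric.mem_closedBall_self (norm_nonneg z)) ?_ (show z ∈ _ by simp)
  filter_upwards [lhsQuad_eventuallyEq hh hq hα hβ hx hd,
    dL.continuous.continuousAt.eventually_ne (show lhsQuadDen h β x 0 ≠ 0 by
      simp [lhsQuadDen_zero]),
    dR.continuous.continuousAt.eventually_ne (show rhsQuadDen (h ^ 2) β x 0 ≠ 0 by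
      simp [rhsQuadDen_zero])] with y e n1 n2
  rwa [lhsQuad, rhsQuad, div_eq_div_iff n1 n2] at e

theorem meromorphic_of_differentiable {f : ℂ → ℂ} (hf : Differentiable ℂ f) : Meromorphic f :=
  fun z => (hf.analyticAt z).meromorphicAt

/-- The common meromorphic continuation of the two sides of the quadratic transformation. -/
theorem exists_meromorphic_lhsQuad (hh : h ≠ 0) (hq : ‖h ^ 2‖ < 1) (hα : α ≠ 0) (hβ : β ≠ 0)
    (hx : x ≠ 0) (hd : ∀ n : ℕ, h ^ 2 * x ^ 2 * (h ^ 2) ^ n ≠ 1) :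
    ∃ M : ℂ → ℂ, Meromorphic M ∧ M =ᶠ[𝓝 0] lhsQuad h α β x := by
  have aL : AnalyticAt ℂ (lhsQuad h α β x) 0 :=
    (analyticAt_lhsQuad_num hh hq hα hβ hx hd (by simp)).div
      ((differentiable_lhsQuadDen hq β x).analyticAt 0) (by simp [lhsQuadDen_zero])
  set C : ℂ → ℂ := fun y => (1 - (h ^ 2 * x / β * y) ^ 2) *
    (1 - (h ^ 2 * (h ^ 2 * x / β * y)) ^ 2) * (1 - (h ^ 2) ^ 3 * y ^ 2) with hC
  have dC : Differentiable ℂ C := by fun_prop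
  have dU : Differentiable ℂ (quadUp (h ^ 2) α β x) := by unfold quadUp; fun_prop
  have dM : Differentiable ℂ fun y => quadMid (h ^ 2) α β x y *
      (1 - (h ^ 2 * (h ^ 2 * x / β * y)) ^ 2) := by unfold quadMid; fun_prop
  -- On this disc the equation holds and C ≠ 0, so it can be solved for the unshifted value.
  obtain ⟨ρ, hρ, hball⟩ := Metric.eventually_nhds_iff_ball.1
    ((lhsQuad_equation hh hq hα hβ hx hd).and
      ((dC.continuous.continuousAt.eventually_ne (show C 0 ≠ 0 by simp [hC])).and
        aL.eventually_analyticAt))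
  obtain ⟨M, hM, hMf⟩ := exists_meromorphic_extension (q := h ^ 2) (f := lhsQuad h α β x) hq hρ
    ((meromorphic_of_differentiable dM).neg.div (meromorphic_of_differentiable dC))
    ((meromorphic_of_differentiable dU).neg.div (meromorphic_of_differentiable dC))
    (fun y hy => (hball y (by simpa using hy)).2.2.meromorphicAt)
    (fun y hy => by
      obtain ⟨e, n, -⟩ := hball y (by simpa using hy)
      simp only [Pi.div_apply, Pi.neg_apply]
      have hCy : C y = (1 - (h ^ 2 * x / β * y) ^ 2) *
        (1 - (h ^ 2 * (h ^ 2 * x / β * y)) ^ 2) * (1 - (h ^ 2) ^ 3 * y ^ 2) := rfl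
      rw [← hCy] at e
      generalize C y = c at *
      generalize quadMid (h ^ 2) α β x y * (1 - (h ^ 2 * (h ^ 2 * x / β * y)) ^ 2) = m at *
      generalize lhsQuad h α β x ((h ^ 2) ^ 2 * y) = F2 at *
      generalize lhsQuad h α β x (h ^ 2 * y) = F1 at *
      field_simp
      linear_combination e)
  refine ⟨M, hM, ?_⟩
  filter_upwards [Metric.ball_mem_nhds 0 hρ] with y hy
  exact hMf y (by simpa using hy)

theorem eventually_nhdsNE_ne_zero {f : ℂ → ℂ} (hf : Differentiable ℂ f) (h0 : f 0 ≠ 0) (z : ℂ) :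
    ∀ᶠ y in 𝓝[≠] z, f y ≠ 0 := by
  by_contra hcon
  have := AnalyticOnNhd.eqOn_zero_of_preconnected_of_frequently_eq_zero
    (fun y _ => hf.analyticAt y) isPreconnected_univ (Set.mem_univ z)
    hcon
  exact h0 (this (Set.mem_univ 0))

/-- Given a meromorphic function `M` and entire functions `num`, `den`, there is a meromorphic
`L` with `num / den * L = M`, whose values are the natural ones wherever possible. -/
theorem exists_meromorphicOn_quotient {M num den V : ℂ → ℂ} {G : Set ℂ} (hM : Meromorphic M)
    (hn : Differentiable ℂ num) (hn0 : num 0 ≠ 0) (hd : Differentiable ℂ den) (hd0 : den 0 ≠ 0)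
    (hV : ∀ z ∈ G, AnalyticAt ℂ V z ∧ ∀ᶠ y in 𝓝[≠] z, num y / den y * V y = M y) :
    ∃ L : ℂ → ℂ, MeromorphicOn L {0}ᶜ ∧ (∀ z ∈ G, z ≠ 0 → L z = V z) ∧
      ∀ z ≠ 0, ∀ᶠ y in 𝓝[≠] z, num y / den y * L y = M y := by
  have hL0 : MeromorphicOn (M * den / num) {0}ᶜ := fun z _ =>
    ((hM z).mul (hd.analyticAt z).meromorphicAt).div (hn.analyticAt z).meromorphicAt
  -- The normal form repairs the values of M * den / num where num or den vanishes: where V is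
  -- analytic, agreement on a punctured neighbourhood forces agreement at the point.
  have hNF := meromorphicNFOn_toMeromorphicNFOn (M * den / num) ({0}ᶜ : Set ℂ)
  refine ⟨toMeromorphicNFOn (M * den / num) {0}ᶜ, hNF.meromorphicOn, fun z hz hz0 => ?_,
    fun z hz0 => ?_⟩
  · obtain ⟨hVa, hVe⟩ := hV z hz
    refine ((MeromorphicNFAt.eventuallyEq_nhdsNE_iff_eventuallyEq_nhds (hNF hz0)
      hVa.meromorphicNFAt).1 ?_).eq_of_nhds
    refine (hL0.toMeromorphicNFOn_eq_self_on_nhdsNE hz0).trans ?_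
    filter_upwards [hVe, eventually_nhdsNE_ne_zero hn hn0 z, eventually_nhdsNE_ne_zero hd hd0 z]
      with y e n1 n2
    simp only [Pi.div_apply, Pi.mul_apply, ← e]
    field_simp
  · filter_upwards [hL0.toMeromorphicNFOn_eq_self_on_nhdsNE hz0,
      eventually_nhdsNE_ne_zero hn hn0 z, eventually_nhdsNE_ne_zero hd hd0 z] with y e n1 n2
    rw [e]
    simp only [Pi.div_apply, Pi.mul_apply]
    field_simp

end Comparison

/-! ### From the regularized sums back to the stated series and prefactors -/

section Transformation

variable {q : ℝ} {α β x : ℂ}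

theorem qHalf_sq (hq : 0 < q) : (q : ℂ) = qHalf q ^ 2 := by
  rw [qHalf, ← Complex.ofReal_pow, Real.sq_sqrt hq.le]

theorem qHalf_ne_zero (hq : 0 < q) : qHalf q ≠ 0 := by
  rw [qHalf]
  exact_mod_cast (Real.sqrt_pos.2 hq).ne'

theorem norm_qHalf_sq_lt_one (hq : 0 < q) (hq1 : q < 1) : ‖qHalf q ^ 2‖ < 1 := by
  rw [← qHalf_sq hq, Complex.norm_real, Real.norm_of_nonneg hq.le]
  exact hq1

theorem lhsParams_eq (hq : 0 < q) (α β x z : ℂ) :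
    lhsParams q α β x z = vwpParams (x ^ 2) (lhsPars (qHalf q) α β x) (-(qHalf q / β) * z) := by
  ext i
  fin_cases i <;> simp [lhsParams, vwpParams, lhsPars, qHalf_sq hq] <;> ring

theorem rhsParams_eq (hq : 0 < q) (α β x z : ℂ) :
    rhsParams q α β x z =
      vwpParams (x ^ 2) (rhsPars (qHalf q ^ 2) α β x) (-qHalf q ^ 2 * z ^ 2) := by
  ext i
  fin_cases i <;> simp [rhsParams, vwpParams, rhsPars, qHalf_sq hq]
  ring

theorem lhsArg_eq (hq : 0 < q) (hα : α ≠ 0) (hβ : β ≠ 0) (hx : x ≠ 0) (z : ℂ) :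
    lhsArg q β z = vwpScale (qHalf q ^ 2) (x ^ 2) (lhsPars (qHalf q) α β x) *
      (-(qHalf q / β) * z) := by
  rw [← mul_assoc, lhs_scale (qHalf_ne_zero hq) hα hβ hx, lhsArg]
  ring

theorem rhsArg_eq (hq : 0 < q) (hα : α ≠ 0) (hβ : β ≠ 0) (hx : x ≠ 0) (z : ℂ) :
    rhsArg q z = vwpScale ((qHalf q ^ 2) ^ 2) (x ^ 2) (rhsPars (qHalf q ^ 2) α β x) *
      (-qHalf q ^ 2 * z ^ 2) := by
  rw [rhs_scale (pow_ne_zero 2 (qHalf_ne_zero hq)) hα hβ hx, rhsArg, qHalf_sq hq]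
  ring

/-- The analytic representative of the series in base `q`. -/
def lhsSeries (h α β x z : ℂ) : ℂ :=
  regSum (h ^ 2) (x ^ 2) (lhsPars h α β x) (-(h / β) * z) / ((1 - x ^ 2 * (-(h / β) * z)) *
    ∏ i, qFactInf (h ^ 2) (h ^ 2 * x ^ 2 * (-(h / β) * z) / lhsPars h α β x i))

/-- The analytic representative of the series in base `q²`. -/
def rhsSeries (q α β x z : ℂ) : ℂ :=
  regSum (q ^ 2) (x ^ 2) (rhsPars q α β x) (-q * z ^ 2) / ((1 - x ^ 2 * (-q * z ^ 2)) *
    ∏ i, qFactInf (q ^ 2) (q ^ 2 * x ^ 2 * (-q * z ^ 2) / rhsPars q α β x i))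

/-- Two of the four products in the denominator of the series cancel against the numerator of the
prefactor, and 1 - x²Z merges with the prefactor's denominator into (x²Z; q)_∞. -/
theorem lhs_prefactor_mul (hq : 0 < q) (hq1 : q < 1) (hα : α ≠ 0) (hβ : β ≠ 0) (hx : x ≠ 0)
    {z : ℂ} (hz : ∀ i, qFactInf (qHalf q ^ 2) (qHalf q ^ 2 * x ^ 2 * (-(qHalf q / β) * z) /
      lhsPars (qHalf q) α β x i) ≠ 0) :
    lhsNum q α β x z / lhsDen q β x z * lhsSeries (qHalf q) α β x z =
      lhsQuad (qHalf q) α β x z := by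
  have hh := qHalf_ne_zero hq
  have hn := norm_qHalf_sq_lt_one hq hq1
  have e0 := hz 0
  have e2 := hz 2
  rw [lhsNum, lhsDen, lhsSeries, lhsQuad, lhsQuadDen, qHalf_sq hq]
  generalize qHalf q = h at *
  rw [qFactInf_eq_mul hn (x ^ 2 * (-(h / β) * z))]
  simp only [qFactInfs, List.map_cons, List.map_nil, List.prod_cons, List.prod_nil, mul_one,
    Fin.prod_univ_four]
  have p0 : h ^ 2 * x ^ 2 * (-(h / β) * z) / lhsPars h α β x 0 = -(h * α * x * z) := by
    simp only [lhsPars, Matrix.cons_val_zero]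
    field_simp
  have p1 : h ^ 2 * x ^ 2 * (-(h / β) * z) / lhsPars h α β x 1 = h ^ 2 * x / β * z := by
    simp only [lhsPars, Matrix.cons_val_one, Matrix.cons_val_zero]
    field_simp
  have p2 : h ^ 2 * x ^ 2 * (-(h / β) * z) / lhsPars h α β x 2 = h ^ 3 * x * z / α := by
    simp only [lhsPars, Matrix.cons_val]
    field_simp
  have p3 : h ^ 2 * x ^ 2 * (-(h / β) * z) / lhsPars h α β x 3 = -(h ^ 2 * x / β) * z := by
    simp only [lhsPars, Matrix.cons_val]
    field_simp
  rw [p0] at e0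
  rw [p2] at e2
  rw [p0, p1, p2, p3, show -(h ^ 3 * x ^ 2 * z / β) = x ^ 2 * (-(h / β) * z) * h ^ 2 by ring,
    show -(h * β * z) = -(h * β) * z by ring]
  generalize qFactInf (h ^ 2) (-(h * α * x * z)) = A0 at *
  generalize qFactInf (h ^ 2) (h ^ 2 * x / β * z) = A1 at *
  generalize qFactInf (h ^ 2) (h ^ 3 * x * z / α) = A2 at *
  generalize qFactInf (h ^ 2) (-(h ^ 2 * x / β) * z) = A3 at *
  generalize qFactInf (h ^ 2) (x ^ 2 * (-(h / β) * z) * h ^ 2) = D at *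
  generalize qFactInf (h ^ 2) (-(h * β) * z) = W at *
  generalize regSum (h ^ 2) (x ^ 2) (lhsPars h α β x) (-(h / β) * z) = S at *
  generalize 1 - x ^ 2 * (-(h / β) * z) = E at *
  calc _ = A0 * A2 * (W * S) / (A0 * A2 * (E * D * (A1 * A3))) := by
        rw [div_mul_div_comm]
        ring
    _ = _ := mul_div_mul_left _ _ (mul_ne_zero e0 e2)

/-- Here all four products cancel against the numerator of the prefactor. -/
theorem rhs_prefactor_mul (hq : 0 < q) (hq1 : q < 1) (hα : α ≠ 0) (hβ : β ≠ 0) (hx : x ≠ 0)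
    {z : ℂ} (hz : ∀ i, qFactInf ((qHalf q ^ 2) ^ 2) ((qHalf q ^ 2) ^ 2 * x ^ 2 *
      (-qHalf q ^ 2 * z ^ 2) / rhsPars (qHalf q ^ 2) α β x i) ≠ 0) :
    rhsNum q α β x z / rhsDen q β x z * rhsSeries (qHalf q ^ 2) α β x z =
      rhsQuad (qHalf q ^ 2) α β x z := by
  have hn := norm_sq_lt_one (norm_qHalf_sq_lt_one hq hq1)
  have hq0 := pow_ne_zero 2 (qHalf_ne_zero hq)
  rw [rhsNum, rhsDen, rhsSeries, rhsQuad, rhsQuadDen, qHalf_sq hq]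
  generalize qHalf q ^ 2 = k at *
  have e0 := hz 0
  have e1 := hz 1
  have e2 := hz 2
  have e3 := hz 3
  rw [qFactInf_eq_mul hn (x ^ 2 * (-k * z ^ 2))]
  simp only [qFactInfs, List.map_cons, List.map_nil, List.prod_cons, List.prod_nil, mul_one,
    Fin.prod_univ_four]
  have p0 : k ^ 2 * x ^ 2 * (-k * z ^ 2) / rhsPars k α β x 0 = -(k * α * β * x * z ^ 2) := by
    simp only [rhsPars, Matrix.cons_val_zero]
    field_simp
  have p1 : k ^ 2 * x ^ 2 * (-k * z ^ 2) / rhsPars k α β x 1 = k ^ 2 * α * x * z ^ 2 / β := by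
    simp only [rhsPars, Matrix.cons_val_one, Matrix.cons_val_zero]
    field_simp
  have p2 : k ^ 2 * x ^ 2 * (-k * z ^ 2) / rhsPars k α β x 2 = k ^ 3 * β * x * z ^ 2 / α := by
    simp only [rhsPars, Matrix.cons_val]
    field_simp
  have p3 : k ^ 2 * x ^ 2 * (-k * z ^ 2) / rhsPars k α β x 3 = -(k ^ 2 * x * z ^ 2 / (α * β)) := by
    simp only [rhsPars, Matrix.cons_val]
    field_simp
  rw [p0] at e0
  rw [p1] at e1
  rw [p2] at e2
  rw [p3] at e3
  rw [p0, p1, p2, p3, show -(k ^ 3 * x ^ 2 * z ^ 2) = x ^ 2 * (-k * z ^ 2) * k ^ 2 by ring,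
    show -(k ^ 2 * z ^ 2) = -k ^ 2 * z ^ 2 by ring,
    show k ^ 2 * x ^ 2 * z ^ 2 / β ^ 2 = k ^ 2 * x ^ 2 / β ^ 2 * z ^ 2 by ring]
  generalize qFactInf (k ^ 2) (-(k * α * β * x * z ^ 2)) = A0 at *
  generalize qFactInf (k ^ 2) (k ^ 2 * α * x * z ^ 2 / β) = A1 at *
  generalize qFactInf (k ^ 2) (k ^ 3 * β * x * z ^ 2 / α) = A2 at *
  generalize qFactInf (k ^ 2) (-(k ^ 2 * x * z ^ 2 / (α * β))) = A3 at *
  generalize qFactInf (k ^ 2) (x ^ 2 * (-k * z ^ 2) * k ^ 2) = D at *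
  generalize qFactInf (k ^ 2) (-k ^ 2 * z ^ 2) = B1 at *
  generalize qFactInf (k ^ 2) (k ^ 2 * x ^ 2 / β ^ 2 * z ^ 2) = B2 at *
  generalize regSum (k ^ 2) (x ^ 2) (rhsPars k α β x) (-k * z ^ 2) = S at *
  generalize 1 - x ^ 2 * (-k * z ^ 2) = E at *
  calc _ = A0 * A1 * A2 * A3 * S / (A0 * A1 * A2 * A3 * (E * D * (B1 * B2))) := by
        rw [div_mul_div_comm]
        ring
    _ = _ := mul_div_mul_left _ _ (mul_ne_zero (mul_ne_zero (mul_ne_zero e0 e1) e2) e3)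

theorem differentiable_lhsNum (hq : 0 < q) (hq1 : q < 1) (α β x : ℂ) :
    Differentiable ℂ (lhsNum q α β x) := by
  have := differentiable_qFactInf (norm_qHalf_sq_lt_one hq hq1)
  unfold lhsNum
  simp only [qFactInfs, List.map_cons, List.map_nil, List.prod_cons, List.prod_nil, qHalf_sq hq]
  fun_prop

theorem differentiable_lhsDen (hq : 0 < q) (hq1 : q < 1) (β x : ℂ) :
    Differentiable ℂ (lhsDen q β x) := by
  have := differentiable_qFactInf (norm_qHalf_sq_lt_one hq hq1)
  unfold lhsDen
  simp only [qFactInfs, List.map_cons, List.map_nil, List.prod_cons, List.prod_nil, qHalf_sq hq]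
  fun_prop

theorem differentiable_rhsNum (hq : 0 < q) (hq1 : q < 1) (α β x : ℂ) :
    Differentiable ℂ (rhsNum q α β x) := by
  have := differentiable_qFactInf (norm_sq_lt_one (norm_qHalf_sq_lt_one hq hq1))
  unfold rhsNum
  simp only [qFactInfs, List.map_cons, List.map_nil, List.prod_cons, List.prod_nil, qHalf_sq hq]
  fun_prop

theorem differentiable_rhsDen (hq : 0 < q) (hq1 : q < 1) (β x : ℂ) :
    Differentiable ℂ (rhsDen q β x) := by
  have := differentiable_qFactInf (norm_sq_lt_one (norm_qHalf_sq_lt_one hq hq1))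
  unfold rhsDen
  simp only [qFactInfs, List.map_cons, List.map_nil, List.prod_cons, List.prod_nil, qHalf_sq hq]
  fun_prop

theorem lhsNum_zero (q : ℝ) (α β x : ℂ) : lhsNum q α β x 0 = 1 := by
  simp [lhsNum, qFactInfs, qFactInf_zero]

theorem lhsDen_zero (q : ℝ) (β x : ℂ) : lhsDen q β x 0 = 1 := by
  simp [lhsDen, qFactInfs, qFactInf_zero]

theorem rhsNum_zero (q : ℝ) (α β x : ℂ) : rhsNum q α β x 0 = 1 := by
  simp [rhsNum, qFactInfs, qFactInf_zero]

theorem rhsDen_zero (q : ℝ) (β x : ℂ) : rhsDen q β x 0 = 1 := by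
  simp [rhsDen, qFactInfs, qFactInf_zero]

end Transformation

/-! ### Meromorphic continuation of each series -/

section Continuation

variable {q : ℝ} {α β x : ℂ}

theorem eventuallyEq_of_meromorphicAt_closedBall {f M : ℂ → ℂ} {z : ℂ}
    (hf : ∀ y, ‖y‖ ≤ ‖z‖ → MeromorphicAt f y) (hM : Meromorphic M) (h : M =ᶠ[𝓝 0] f) :
    f =ᶠ[𝓝[≠] z] M :=
  MeromorphicOn.eventuallyEq_of_isPreconnected (U := Metric.closedBall 0 ‖z‖)
    (fun y hy => hf y (by simpa using hy)) (fun y _ => hM y)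
    (convex_closedBall _ _).isPreconnected (Metric.mem_closedBall_self (norm_nonneg z)) (by simp)
    (h.symm.filter_mono nhdsWithin_le_nhds)

theorem one_sub_ne_zero_of_generic {q d Z : ℂ} {p : Fin 4 → ℂ}
    (hgen : VWPGeneric (vwpParams d p Z) q) : 1 - d * Z ≠ 0 :=
  sub_ne_zero.2 (by simpa [vwpParams] using hgen.1.symm)

theorem lhsQuadDen_ne_zero (hq : 0 < q) (hq1 : q < 1) (hβ : β ≠ 0) (hx : x ≠ 0) {z : ℂ}
    (hgen : VWPGeneric (vwpParams (x ^ 2) (lhsPars (qHalf q) α β x) (-(qHalf q / β) * z))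
      (qHalf q ^ 2)) (hden : lhsDen q β x z ≠ 0) : lhsQuadDen (qHalf q) β x z ≠ 0 := by
  have hh := qHalf_ne_zero hq
  have hn := norm_qHalf_sq_lt_one hq hq1
  have e0 := one_sub_ne_zero_of_generic hgen
  have e1 := hgen.qFactInf_ne_zero hn 1
  have e3 := hgen.qFactInf_ne_zero hn 3
  simp only [lhsDen, qFactInfs, List.map_cons, List.map_nil, List.prod_cons, List.prod_nil,
    mul_one, qHalf_sq hq] at hden
  generalize qHalf q = h at *
  rw [lhsQuadDen, qFactInf_eq_mul hn (x ^ 2 * (-(h / β) * z)),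
    show x ^ 2 * (-(h / β) * z) * h ^ 2 = -(h ^ 3 * x ^ 2 * z / β) by ring]
  have p1 : h ^ 2 * x ^ 2 * (-(h / β) * z) / lhsPars h α β x 1 = h ^ 2 * x / β * z := by
    simp only [lhsPars, Matrix.cons_val_one, Matrix.cons_val_zero]
    field_simp
  have p3 : h ^ 2 * x ^ 2 * (-(h / β) * z) / lhsPars h α β x 3 = -(h ^ 2 * x / β) * z := by
    simp only [lhsPars, Matrix.cons_val]
    field_simp
  rw [p1] at e1
  rw [p3] at e3
  exact mul_ne_zero (mul_ne_zero e0 hden) (mul_ne_zero e1 e3)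

theorem rhsQuadDen_ne_zero (hq : 0 < q) (hq1 : q < 1) {z : ℂ}
    (hgen : VWPGeneric (vwpParams (x ^ 2) (rhsPars (qHalf q ^ 2) α β x) (-qHalf q ^ 2 * z ^ 2))
      ((qHalf q ^ 2) ^ 2)) (hden : rhsDen q β x z ≠ 0) : rhsQuadDen (qHalf q ^ 2) β x z ≠ 0 := by
  have hn := norm_sq_lt_one (norm_qHalf_sq_lt_one hq hq1)
  have e0 := one_sub_ne_zero_of_generic hgen
  simp only [rhsDen, qFactInfs, List.map_cons, List.map_nil, List.prod_cons, List.prod_nil,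
    mul_one, qHalf_sq hq] at hden
  generalize qHalf q ^ 2 = k at *
  rw [rhsQuadDen, qFactInf_eq_mul hn (x ^ 2 * (-k * z ^ 2)), mul_assoc (1 - _),
    show x ^ 2 * (-k * z ^ 2) * k ^ 2 = -(k ^ 3 * x ^ 2 * z ^ 2) by ring,
    show -k ^ 2 * z ^ 2 = -(k ^ 2 * z ^ 2) by ring,
    show k ^ 2 * x ^ 2 / β ^ 2 * z ^ 2 = k ^ 2 * x ^ 2 * z ^ 2 / β ^ 2 by ring]
  exact mul_ne_zero e0 hden

/-- The prefactor may vanish or have a pole at a point where the series is defined. The quotient is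
therefore compared with the series only on punctured neighbourhoods, and analyticity of the series
fixes the value at the point. -/
theorem exists_lhs_continuation (hq : 0 < q) (hq1 : q < 1) (hα : α ≠ 0) (hβ : β ≠ 0)
    (hx : x ≠ 0) (hd : ∀ n : ℕ, qHalf q ^ 2 * x ^ 2 * (qHalf q ^ 2) ^ n ≠ 1) {M : ℂ → ℂ}
    (hM : Meromorphic M) (hM0 : M =ᶠ[𝓝 0] lhsQuad (qHalf q) α β x) :
    ∃ L : ℂ → ℂ, MeromorphicOn L {0}ᶜ ∧ (∀ z, z ≠ 0 → ‖-(qHalf q * β) * z‖ < 1 →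
      VWPGeneric (vwpParams (x ^ 2) (lhsPars (qHalf q) α β x) (-(qHalf q / β) * z))
        (qHalf q ^ 2) → L z = lhsSeries (qHalf q) α β x z) ∧
      ∀ z ≠ 0, ∀ᶠ y in 𝓝[≠] z, lhsNum q α β x y / lhsDen q β x y * L y = M y := by
  have hh := qHalf_ne_zero hq
  have hn := norm_qHalf_sq_lt_one hq hq1
  have hdiff := differentiable_qFactInf hn
  obtain ⟨L, hL, hL1, hL2⟩ := exists_meromorphicOn_quotient (V := lhsSeries (qHalf q) α β x)
    (G := {z | ‖-(qHalf q * β) * z‖ < 1 ∧ VWPGeneric (vwpParams (x ^ 2)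
      (lhsPars (qHalf q) α β x) (-(qHalf q / β) * z)) (qHalf q ^ 2)}) hM
    (differentiable_lhsNum hq hq1 α β x) (by simp [lhsNum_zero])
    (differentiable_lhsDen hq hq1 β x) (by simp [lhsDen_zero])
    (fun z hz => by
      obtain ⟨hz, hgen⟩ := hz
      have hfac : ∀ i, Differentiable ℂ fun y => qFactInf (qHalf q ^ 2)
          (qHalf q ^ 2 * x ^ 2 * (-(qHalf q / β) * y) / lhsPars (qHalf q) α β x i) :=
        fun i => by fun_prop
      constructor
      · have h2 : AnalyticAt ℂ (regSum (qHalf q ^ 2) (x ^ 2) (lhsPars (qHalf q) α β x))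
            (-(qHalf q / β) * z) :=
          analyticAt_regSum hn hd (by rwa [← mul_assoc, lhs_scale hh hα hβ hx])
        refine (h2.comp (g := regSum (qHalf q ^ 2) (x ^ 2) (lhsPars (qHalf q) α β x))
          (f := fun z => -(qHalf q / β) * z) (by fun_prop)).div ?_ (hgen.regFactor_ne_zero hn)
        refine Differentiable.analyticAt ?_ z
        have := Differentiable.fun_finsetProd (u := Finset.univ) fun i _ => hfac i
        fun_prop
      -- The function `lhsQuad` is meromorphic on the closed disc of radius ‖z‖ and agrees with M
      -- near 0, hence also around z.
      · have hmer : ∀ y, ‖y‖ ≤ ‖z‖ → MeromorphicAt (lhsQuad (qHalf q) α β x) y := fun y hy => by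
          refine (analyticAt_lhsQuad_num hh hn hα hβ hx hd (lt_of_le_of_lt ?_ hz)).meromorphicAt.div
            ((differentiable_lhsQuadDen hn β x).analyticAt y).meromorphicAt
          rw [norm_mul, norm_mul]
          gcongr
        have hne : ∀ᶠ y in 𝓝 z, ∀ i, qFactInf (qHalf q ^ 2)
            (qHalf q ^ 2 * x ^ 2 * (-(qHalf q / β) * y) / lhsPars (qHalf q) α β x i) ≠ 0 :=
          eventually_all.2 fun i => (hfac i).continuous.continuousAt.eventually_ne
            (hgen.qFactInf_ne_zero hn i)
        filter_upwards [eventuallyEq_of_meromorphicAt_closedBall hmer hM hM0,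
          hne.filter_mono nhdsWithin_le_nhds] with y e1 e2
        rw [lhs_prefactor_mul hq hq1 hα hβ hx e2, e1])
  exact ⟨L, hL, fun z hz0 hz hgen => hL1 z ⟨hz, hgen⟩ hz0, hL2⟩

theorem exists_rhs_continuation (hq : 0 < q) (hq1 : q < 1) (hα : α ≠ 0) (hβ : β ≠ 0)
    (hx : x ≠ 0) (hd : ∀ n : ℕ, qHalf q ^ 2 * x ^ 2 * (qHalf q ^ 2) ^ n ≠ 1) {M : ℂ → ℂ}
    (hM : Meromorphic M) (hM0 : M =ᶠ[𝓝 0] rhsQuad (qHalf q ^ 2) α β x) :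
    ∃ R : ℂ → ℂ, MeromorphicOn R {0}ᶜ ∧ (∀ z, z ≠ 0 → ‖-qHalf q ^ 2 * z ^ 2‖ < 1 →
      VWPGeneric (vwpParams (x ^ 2) (rhsPars (qHalf q ^ 2) α β x) (-qHalf q ^ 2 * z ^ 2))
        ((qHalf q ^ 2) ^ 2) → R z = rhsSeries (qHalf q ^ 2) α β x z) ∧
      ∀ z ≠ 0, ∀ᶠ y in 𝓝[≠] z, rhsNum q α β x y / rhsDen q β x y * R y = M y := by
  have hk := pow_ne_zero 2 (qHalf_ne_zero hq)
  have hn := norm_sq_lt_one (norm_qHalf_sq_lt_one hq hq1)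
  have hd2 := mul_pow_ne_one_of_sq hd
  have hdiff := differentiable_qFactInf hn
  obtain ⟨R, hR, hR1, hR2⟩ := exists_meromorphicOn_quotient (V := rhsSeries (qHalf q ^ 2) α β x)
    (G := {z | ‖-qHalf q ^ 2 * z ^ 2‖ < 1 ∧ VWPGeneric (vwpParams (x ^ 2)
      (rhsPars (qHalf q ^ 2) α β x) (-qHalf q ^ 2 * z ^ 2)) ((qHalf q ^ 2) ^ 2)}) hM
    (differentiable_rhsNum hq hq1 α β x) (by simp [rhsNum_zero])
    (differentiable_rhsDen hq hq1 β x) (by simp [rhsDen_zero])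
    (fun z hz => by
      obtain ⟨hz, hgen⟩ := hz
      have hfac : ∀ i, Differentiable ℂ fun y => qFactInf ((qHalf q ^ 2) ^ 2)
          ((qHalf q ^ 2) ^ 2 * x ^ 2 * (-qHalf q ^ 2 * y ^ 2) / rhsPars (qHalf q ^ 2) α β x i) :=
        fun i => by fun_prop
      constructor
      · refine (analyticAt_rhsQuad_num hk hn hα hβ hx hd2 hz).div ?_ (hgen.regFactor_ne_zero hn)
        refine Differentiable.analyticAt ?_ z
        have := Differentiable.fun_finsetProd (u := Finset.univ) fun i _ => hfac i
        fun_prop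
      · have hmer : ∀ y, ‖y‖ ≤ ‖z‖ → MeromorphicAt (rhsQuad (qHalf q ^ 2) α β x) y :=
          fun y hy => by
          refine (analyticAt_rhsQuad_num hk hn hα hβ hx hd2
            (lt_of_le_of_lt ?_ hz)).meromorphicAt.div
            ((differentiable_rhsQuadDen hn β x).analyticAt y).meromorphicAt
          rw [norm_mul, norm_mul, norm_pow y, norm_pow z]
          gcongr
        have hne : ∀ᶠ y in 𝓝 z, ∀ i, qFactInf ((qHalf q ^ 2) ^ 2) ((qHalf q ^ 2) ^ 2 * x ^ 2 *
            (-qHalf q ^ 2 * y ^ 2) / rhsPars (qHalf q ^ 2) α β x i) ≠ 0 :=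
          eventually_all.2 fun i => (hfac i).continuous.continuousAt.eventually_ne
            (hgen.qFactInf_ne_zero hn i)
        filter_upwards [eventuallyEq_of_meromorphicAt_closedBall hmer hM hM0,
          hne.filter_mono nhdsWithin_le_nhds] with y e1 e2
        rw [rhs_prefactor_mul hq hq1 hα hβ hx e2, e1])
  exact ⟨R, hR, fun z hz0 hz hgen => hR1 z ⟨hz, hgen⟩ hz0, hR2⟩

end Continuation

/-! ### The stated series and the final assembly -/

section MainTheorem

variable {q : ℝ} {α β x : ℂ}

theorem W87_lhsParams (hq : 0 < q) (hq1 : q < 1) (hα : α ≠ 0) (hβ : β ≠ 0) (hx : x ≠ 0) {z : ℂ}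
    (hz : z ≠ 0) (hgen : VWPGeneric (lhsParams q α β x z) (q : ℂ)) :
    W87 (lhsParams q α β x z) (q : ℂ) (lhsArg q β z) = lhsSeries (qHalf q) α β x z := by
  have hh := qHalf_ne_zero hq
  rw [lhsParams_eq hq, qHalf_sq hq] at hgen
  rw [lhsParams_eq hq, qHalf_sq hq, lhsArg_eq hq hα hβ hx,
    W87_eq (norm_qHalf_sq_lt_one hq hq1) (pow_ne_zero 2 hx)
      (mul_ne_zero (neg_ne_zero.2 (div_ne_zero hh hβ)) hz) hgen, lhsSeries]

theorem W87_rhsParams (hq : 0 < q) (hq1 : q < 1) (hα : α ≠ 0) (hβ : β ≠ 0) (hx : x ≠ 0) {z : ℂ}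
    (hz : z ≠ 0) (hgen : VWPGeneric (rhsParams q α β x z) ((q : ℂ) ^ 2)) :
    W87 (rhsParams q α β x z) ((q : ℂ) ^ 2) (rhsArg q z) =
      rhsSeries (qHalf q ^ 2) α β x z := by
  have hk := pow_ne_zero 2 (qHalf_ne_zero hq)
  rw [rhsParams_eq hq, qHalf_sq hq] at hgen
  rw [rhsParams_eq hq, qHalf_sq hq, rhsArg_eq hq hα hβ hx,
    W87_eq (norm_sq_lt_one (norm_qHalf_sq_lt_one hq hq1)) (pow_ne_zero 2 hx)
      (mul_ne_zero (neg_ne_zero.2 hk) (pow_ne_zero 2 hz)) hgen, rhsSeries]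

end MainTheorem

end

/-- The dual quadratic transformation formula for very-well-poised `₈W₇` series: first as an
identity between convergent series, then as an identity between the meromorphic continuations
in `z` of the two series to the punctured plane. -/
theorem mainTheorem8 (q : ℝ) (hq0 : 0 < q) (hq1 : q < 1) (α β x : ℂ)
    (hα : α ≠ 0) (hβ : β ≠ 0) (hx : x ≠ 0) (hqx : ∀ n : ℕ, (q : ℂ) ^ (n + 1) * x ^ 2 ≠ 1) :
    (∀ z : ℂ, z ≠ 0 → ‖lhsArg q β z‖ < 1 → ‖rhsArg q z‖ < 1 →
      VWPGeneric (lhsParams q α β x z) (q : ℂ) →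
      VWPGeneric (rhsParams q α β x z) ((q : ℂ) ^ 2) →
      lhsDen q β x z ≠ 0 → rhsDen q β x z ≠ 0 →
        Summable (vwpTerm (lhsParams q α β x z) (q : ℂ) (lhsArg q β z)) ∧
        Summable (vwpTerm (rhsParams q α β x z) ((q : ℂ) ^ 2) (rhsArg q z)) ∧
        lhsNum q α β x z / lhsDen q β x z *
            W87 (lhsParams q α β x z) (q : ℂ) (lhsArg q β z) =
          rhsNum q α β x z / rhsDen q β x z *
            W87 (rhsParams q α β x z) ((q : ℂ) ^ 2) (rhsArg q z)) ∧
    (∃ L R : ℂ → ℂ, MeromorphicOn L {0}ᶜ ∧ MeromorphicOn R {0}ᶜ ∧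
      (∀ z : ℂ, z ≠ 0 → ‖lhsArg q β z‖ < 1 → VWPGeneric (lhsParams q α β x z) (q : ℂ) →
        L z = W87 (lhsParams q α β x z) (q : ℂ) (lhsArg q β z)) ∧
      (∀ z : ℂ, z ≠ 0 → ‖rhsArg q z‖ < 1 →
        VWPGeneric (rhsParams q α β x z) ((q : ℂ) ^ 2) →
        R z = W87 (rhsParams q α β x z) ((q : ℂ) ^ 2) (rhsArg q z)) ∧
      ∀ᶠ z in codiscreteWithin ({0}ᶜ : Set ℂ),
        lhsNum q α β x z / lhsDen q β x z * L z =
          rhsNum q α β x z / rhsDen q β x z * R z) := by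
  have hh := qHalf_ne_zero hq0
  have hn := norm_qHalf_sq_lt_one hq0 hq1
  have hk := pow_ne_zero 2 hh
  have hn2 := norm_sq_lt_one hn
  have hd : ∀ n : ℕ, qHalf q ^ 2 * x ^ 2 * (qHalf q ^ 2) ^ n ≠ 1 := fun n => by
    have := hqx n
    rw [qHalf_sq hq0] at this
    rwa [show qHalf q ^ 2 * x ^ 2 * (qHalf q ^ 2) ^ n = (qHalf q ^ 2) ^ (n + 1) * x ^ 2 by ring]
  have hd2 := mul_pow_ne_one_of_sq hd
  have argL : ∀ z, lhsArg q β z = -(qHalf q * β) * z := fun z => by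
    rw [lhsArg]
    ring
  have argR : ∀ z, rhsArg q z = -qHalf q ^ 2 * z ^ 2 := fun z => by
    rw [rhsArg, qHalf_sq hq0]
    ring
  constructor
  · intro z hz hz1 hz2 hgL hgR hL hR
    have hgL' := hgL
    have hgR' := hgR
    rw [lhsParams_eq hq0, qHalf_sq hq0] at hgL'
    rw [rhsParams_eq hq0, qHalf_sq hq0] at hgR'
    refine ⟨?_, ?_, ?_⟩
    · rw [lhsArg_eq hq0 hα hβ hx] at hz1 ⊢
      rw [lhsParams_eq hq0, qHalf_sq hq0]
      exact summable_vwpTerm hn (pow_ne_zero 2 hx) hd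
        (mul_ne_zero (neg_ne_zero.2 (div_ne_zero hh hβ)) hz) hz1 hgL'
    · rw [rhsArg_eq hq0 hα hβ hx] at hz2 ⊢
      rw [rhsParams_eq hq0, qHalf_sq hq0]
      exact summable_vwpTerm hn2 (pow_ne_zero 2 hx) hd2
        (mul_ne_zero (neg_ne_zero.2 hk) (pow_ne_zero 2 hz)) hz2 hgR'
    · rw [argL] at hz1
      rw [argR] at hz2
      rw [W87_lhsParams hq0 hq1 hα hβ hx hz hgL, W87_rhsParams hq0 hq1 hα hβ hx hz hgR,
        lhs_prefactor_mul hq0 hq1 hα hβ hx fun i => hgL'.qFactInf_ne_zero hn i,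
        rhs_prefactor_mul hq0 hq1 hα hβ hx fun i => hgR'.qFactInf_ne_zero hn2 i]
      exact lhsQuad_eq_rhsQuad hh hn hα hβ hx hd hz1 hz2
        (lhsQuadDen_ne_zero hq0 hq1 hβ hx hgL' hL) (rhsQuadDen_ne_zero hq0 hq1 hgR' hR)
  · obtain ⟨M, hM, hM0⟩ := exists_meromorphic_lhsQuad hh hn hα hβ hx hd
    obtain ⟨L, hL, hL1, hL2⟩ := exists_lhs_continuation hq0 hq1 hα hβ hx hd hM hM0
    obtain ⟨R, hR, hR1, hR2⟩ := exists_rhs_continuation hq0 hq1 hα hβ hx hd hM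
      -- The two sides agree near 0, so the same M continues the right side. Both products therefore
      -- equal M off a discrete set.
      (hM0.trans (lhsQuad_eventuallyEq hh hn hα hβ hx hd))
    refine ⟨L, R, hL, hR, fun z hz hz1 hgen => ?_, fun z hz hz1 hgen => ?_, ?_⟩
    · rw [W87_lhsParams hq0 hq1 hα hβ hx hz hgen]
      rw [argL] at hz1
      rw [lhsParams_eq hq0, qHalf_sq hq0] at hgen
      exact hL1 z hz hz1 hgen
    · rw [W87_rhsParams hq0 hq1 hα hβ hx hz hgen]
      rw [argR] at hz1
      rw [rhsParams_eq hq0, qHalf_sq hq0] at hgen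
      exact hR1 z hz hz1 hgen
    · refine mem_codiscreteWithin_iff_forall_mem_nhdsNE.2 fun z hz => ?_
      filter_upwards [hL2 z hz, hR2 z hz] with y e1 e2
      exact Or.inl (e1.trans e2.symm)
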